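/- Let $(M,\omega)$ be a compact simply connected symplectic manifold of dimension $2n$, $L\to M$ a Hermitian complex line bundle and $a$ a Hermitian connection on $L$, with covariant derivative $\nabla$ and curvature $2\pi i\,\omega$. Fix a closed connected oriented $n$-manifold $S_0$ and a class $\kappa\in H_n(M,\mathbb Z)$. Let $\mathcal B_S$ be the set of Lagrangian submanifolds $S\subset M$ that are images of embeddings $i:S_0\to M$ with $i_*[S_0]=\kappa$ and over which $(L,a)|_S$ admits a nowhere vanishing covariantly constant section $\sigma_S$. Let $\Gamma(M,L)$ be the space of smooth sections, and let $\mathcal U_{SBS}(a)\subset \mathbb P\,\Gamma(M,L)\times\mathcal B_S$ be the set of pairs $([\alpha],S)$ with $\alpha|_S=e^{ic}f\,\sigma_S$ for a real constant $c$ and a strictly positive $f\in C^\infty(S,\mathbb R)$. For $p=[\alpha]$ with zero set $D$, let $\rho(p)=\nabla\alpha/\alpha$, a complex 1-form on $M\setminus D$. Let $F\in C^\infty(M,\mathbb R)$, let $X_F$ be its Hamiltonian vector field, $\phi^t=\phi^t_{X_F}$ its flow, $t\in\mathbb R$, and let $(p,S)\in\mathcal U_{SBS}(a)$, $p=[\alpha]$,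 with zero set $D$. (1) The diffeomorphism $\phi^t$ lifts to a fibrewise complex linear, isometric, connection preserving smooth bundle map $\Phi$ of $L$, and the class $\phi^t(p):=[\Phi\circ\alpha\circ\phi^{-t}]$ does not depend on the choice of such a lift $\Phi$. The pair $(\phi^t(p),\phi^t(S))$ belongs to $\mathcal U_{SBS}(a)$. (2) Suppose that $\phi^t(D)=D$. Then $S$ and $\phi^t(S)$ are disjoint from $D$, $\operatorname{Im}\rho(p)|_S=0$, the class $\phi^t(p)$ has zero set $D$, and $\rho(\phi^t(p))=(\phi^{-t})^*\rho(p)$ on $M\setminus D$. Moreover every $q\in\mathbb P\,\Gamma(M,L)$ with zero set $D$ and $\rho(q)=(\phi^{-t})^*\rho(p)$ on $M\setminus D$ (in particular $q=\phi^t(p)$) satisfies $\operatorname{Im}\rho(q)|_{\phi^t(S)}=0$ and $(q,\phi^t(S))\in\mathcal U_{SBS}(a)$; if $M\setminus D$ is connected, $q=\phi^t(p)$ is the only such class. -/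

import Mathlib

open Bundle Manifold
open scoped ContDiff Manifold Topology LinearAlgebra.Projectivization

universe u v

noncomputable section

/-! ### Symplectic manifolds and Hamiltonian flows -/

section Symplectic

variable (n : ℕ) (M : Type u) [TopologicalSpace M]
  [ChartedSpace (EuclideanSpace ℝ (Fin (2 * n))) M] [IsManifold (𝓡 (2 * n)) ∞ M]

variable {n M} in
/-- `X` is a smooth vector field on `M`. -/
def IsSmoothVectorField (X : Π x : M, TangentSpace (𝓡 (2 * n)) x) : Prop :=
  ContMDiff (𝓡 (2 * n)) (𝓡 (2 * n)).tangent ∞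
    (fun x => (⟨x, X x⟩ : TangentBundle (𝓡 (2 * n)) M))

/-- A symplectic form on a smooth manifold of dimension `2 * n`: a smooth 2-form which is
nondegenerate and closed. Closedness is the vanishing of the exterior derivative, written by means
of its invariant formula on smooth vector fields. -/
structure SymplecticForm where
  /-- the 2-form at a point -/
  form : ∀ x : M, TangentSpace (𝓡 (2 * n)) x →L[ℝ] TangentSpace (𝓡 (2 * n)) x →L[ℝ] ℝ
  smooth : ∀ X Y : Π x : M, TangentSpace (𝓡 (2 * n)) x,
    IsSmoothVectorField X → IsSmoothVectorField Y →
      ContMDiff (𝓡 (2 * n)) 𝓘(ℝ, ℝ) ∞ (fun x => form x (X x) (Y x))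
  alternating : ∀ (x : M) (w : TangentSpace (𝓡 (2 * n)) x), form x w w = 0
  nondegenerate : ∀ (x : M) (w : TangentSpace (𝓡 (2 * n)) x),
    (∀ w' : TangentSpace (𝓡 (2 * n)) x, form x w w' = 0) → w = 0
  closed : ∀ X Y Z : Π x : M, TangentSpace (𝓡 (2 * n)) x,
    IsSmoothVectorField X → IsSmoothVectorField Y → IsSmoothVectorField Z → ∀ x : M,
      mvfderiv (𝓡 (2 * n)) (fun y => form y (Y y) (Z y)) x (X x)
        + mvfderiv (𝓡 (2 * n)) (fun y => form y (Z y) (X y)) x (Y x)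
        + mvfderiv (𝓡 (2 * n)) (fun y => form y (X y) (Y y)) x (Z x)
        - form x (VectorField.mlieBracket (𝓡 (2 * n)) X Y x) (Z x)
        - form x (VectorField.mlieBracket (𝓡 (2 * n)) Y Z x) (X x)
        - form x (VectorField.mlieBracket (𝓡 (2 * n)) Z X x) (Y x) = 0

variable {n M}

/-- By nondegeneracy every covector is `Ω(w, ·)` for a unique tangent vector `w`. -/
theorem SymplecticForm.existsUnique_vector (Ω : SymplecticForm n M) (x : M)
    (l : TangentSpace (𝓡 (2 * n)) x →L[ℝ] ℝ) :
    ∃! w : TangentSpace (𝓡 (2 * n)) x, Ω.form x w = l := by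
  have hinj : Function.Injective
      (fun w : EuclideanSpace ℝ (Fin (2 * n)) => (Ω.form x w : _ →L[ℝ] ℝ)) := by
    intro a b hab
    have h : Ω.form x (a - b) = 0 := (map_sub (Ω.form x) a b).trans (sub_eq_zero.mpr hab)
    have := Ω.nondegenerate x (a - b) (fun w' => by rw [h]; rfl)
    exact sub_eq_zero.mp this
  let A : EuclideanSpace ℝ (Fin (2 * n)) →ₗ[ℝ] Module.Dual ℝ (EuclideanSpace ℝ (Fin (2 * n))) :=
    { toFun := fun w => (Ω.form x w : EuclideanSpace ℝ (Fin (2 * n)) →L[ℝ] ℝ).toLinearMap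
      map_add' := fun a b => by
        ext w
        exact congrArg (fun m : TangentSpace (𝓡 (2 * n)) x →L[ℝ] ℝ => m w)
          (map_add (Ω.form x) a b)
      map_smul' := fun c a => by
        ext w
        exact congrArg (fun m : TangentSpace (𝓡 (2 * n)) x →L[ℝ] ℝ => m w)
          (map_smul (Ω.form x) c a) }
  have hA : Function.Injective A := fun a b hab =>
    hinj (ContinuousLinearMap.coe_injective hab)
  have hs : Function.Surjective A :=
    (LinearMap.injective_iff_surjective_of_finrank_eq_finrank
      (Subspace.dual_finrank_eq).symm).mp hA
  obtain ⟨w, hw⟩ := hs (ContinuousLinearMap.toLinearMap l)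
  refine ⟨w, ContinuousLinearMap.coe_injective hw, fun w' hw' => hinj ?_⟩
  exact hw'.trans (ContinuousLinearMap.coe_injective hw).symm

/-- The Hamiltonian vector field `X_F` of a function `F`, given by `Ω(X_F, ·) = dF`. -/
def hamiltonianVectorField (Ω : SymplecticForm n M) (F : M → ℝ) :
    Π x : M, TangentSpace (𝓡 (2 * n)) x :=
  fun x => (Ω.existsUnique_vector x (mvfderiv (𝓡 (2 * n)) F x)).choose

/-- `φ` is the (global, smooth) flow of the Hamiltonian vector field `X_F`. -/
structure IsHamiltonianFlow (Ω : SymplecticForm n M) (F : M → ℝ) (φ : ℝ → M → M) : Prop where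
  smooth : ContMDiff (𝓘(ℝ, ℝ).prod (𝓡 (2 * n))) (𝓡 (2 * n)) ∞
    (fun z : ℝ × M => φ z.1 z.2)
  zero : ∀ x : M, φ 0 x = x
  add : ∀ (s t : ℝ) (x : M), φ (s + t) x = φ s (φ t x)
  integralCurve : ∀ x : M,
    IsMIntegralCurve (I := 𝓡 (2 * n)) (fun t => φ t x) (hamiltonianVectorField Ω F)

end Symplectic

/-! ### Homology classes -/

/-- Integral singular homology of a topological space. -/
abbrev integralHomology (k : ℕ) (X : Type u) [TopologicalSpace X] : ModuleCat.{u} ℤ :=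
  ((AlgebraicTopology.singularHomologyFunctor (ModuleCat.{u} ℤ) k).obj
    (ModuleCat.of ℤ (ULift.{u} ℤ))).obj (TopCat.of X)

/-- The map induced in integral singular homology by a continuous map. -/
def integralHomologyMap (k : ℕ) {X Y : Type u} [TopologicalSpace X] [TopologicalSpace Y]
    (f : C(X, Y)) : integralHomology k X →ₗ[ℤ] integralHomology k Y :=
  (((AlgebraicTopology.singularHomologyFunctor (ModuleCat.{u} ℤ) k).obj
    (ModuleCat.of ℤ (ULift.{u} ℤ))).map (TopCat.ofHom f)).hom

/-- A fundamental class of a closed connected `k`-manifold `X`: a generator of the infinite cyclic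
group `H_k(X; ℤ)`. One exists exactly when `X` is orientable, and then it is the choice of an
orientation. -/
def IsFundamentalClass (k : ℕ) (X : Type u) [TopologicalSpace X]
    (o : integralHomology k X) : Prop :=
  ∀ z : integralHomology k X, ∃! m : ℤ, m • o = z

/-! ### Hermitian line bundles, prequantum connections -/

section LineBundle

variable {n : ℕ} {M : Type u} [TopologicalSpace M]
  [ChartedSpace (EuclideanSpace ℝ (Fin (2 * n))) M] [IsManifold (𝓡 (2 * n)) ∞ M]
  (L : M → Type v) [∀ x, NormedAddCommGroup (L x)] [∀ x, InnerProductSpace ℂ (L x)]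
  [TopologicalSpace (TotalSpace ℂ L)] [FiberBundle ℂ L]
  [VectorBundle ℂ ℂ L] [VectorBundle ℝ ℂ L] [ContMDiffVectorBundle ∞ ℂ L (𝓡 (2 * n))]

/-- `Γ(M, L)`, the complex vector space of smooth sections of the line bundle `L`. -/
def smoothSections : Submodule ℂ (Π x : M, L x) where
  carrier := {s | ContMDiff (𝓡 (2 * n)) ((𝓡 (2 * n)).prod 𝓘(ℝ, ℂ)) ∞
    (fun x => (⟨x, s x⟩ : TotalSpace ℂ L))}
  add_mem' := fun hs ht => ContMDiff.add_section hs ht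
  zero_mem' := contMDiff_zeroSection ℝ L
  smul_mem' := by
    intro c s hs x
    have h := (contMDiffAt_section x).mp (hs x)
    refine (contMDiffAt_section x).mpr ?_
    have h2 : ContMDiffAt (𝓡 (2 * n)) 𝓘(ℝ, ℂ) ∞
        (fun y => c • (trivializationAt ℂ L x ⟨y, s y⟩).2) x :=
      ((ContinuousLinearMap.lsmul ℝ ℂ c : ℂ →L[ℝ] ℂ).contDiff.contMDiff.contMDiffAt).comp x h
    refine h2.congr_of_eventuallyEq ?_
    filter_upwards [(trivializationAt ℂ L x).open_baseSet.mem_nhds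
      (mem_baseSet_trivializationAt ℂ L x)] with y hy
    exact ((trivializationAt ℂ L x).linear ℂ hy).map_smul c (s y)

/-- The Hermitian structure on the fibres of `L` depends smoothly on the point. -/
def IsSmoothHermitian : Prop :=
  ∀ s ∈ smoothSections (n := n) L, ∀ t ∈ smoothSections (n := n) L,
    ContMDiff (𝓡 (2 * n)) 𝓘(ℝ, ℂ) ∞ (fun x => inner ℂ (s x) (t x))

variable {L}

/-- `∇` is the covariant derivative of a smooth Hermitian connection on `L` with
curvature `2πi Ω`. -/
structure IsPrequantumConnection (Ω : SymplecticForm n M)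
    (nabla : CovariantDerivative (𝓡 (2 * n)) ℂ L) : Prop where
  smooth : CovariantDerivative.ContMDiffCovariantDerivative nabla ∞
  complexLinear : ∀ s ∈ smoothSections (n := n) L, ∀ (c : ℂ) (x : M)
    (w : TangentSpace (𝓡 (2 * n)) x), nabla (c • s) x w = c • nabla s x w
  hermitian : ∀ s ∈ smoothSections (n := n) L, ∀ t ∈ smoothSections (n := n) L,
    ∀ (x : M) (w : TangentSpace (𝓡 (2 * n)) x),
      mvfderiv (𝓡 (2 * n)) (fun y => (inner ℂ (s y) (t y) : ℂ)) x w
        = inner ℂ (nabla s x w) (t x) + inner ℂ (s x) (nabla t x w)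
  curvature : ∀ X Y : Π x : M, TangentSpace (𝓡 (2 * n)) x,
    IsSmoothVectorField X → IsSmoothVectorField Y → ∀ s ∈ smoothSections (n := n) L, ∀ x : M,
      nabla (fun y => nabla s y (Y y)) x (X x) - nabla (fun y => nabla s y (X y)) x (Y x)
        - nabla s x (VectorField.mlieBracket (𝓡 (2 * n)) X Y x)
        = (2 * (Real.pi : ℂ) * Complex.I * (Ω.form x (X x) (Y x) : ℂ)) • s x

/-- The zero set of (any representative of) a point of `ℙ Γ(M, L)`. -/
def zeroSet (p : ℙ ℂ (smoothSections (n := n) L)) : Set M :=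
  {x | (p.rep : Π x : M, L x) x = 0}

/-- The complex 1-form `ρ(p) = ∇α / α` attached to `p = [α]`, to be used on the complement of the
zero set of `p`. For `α x ≠ 0` the vector `∇α x w` of the complex line `L x` is a unique multiple of
`α x`, and the coefficient is computed by the Hermitian product. -/
def rhoForm (nabla : CovariantDerivative (𝓡 (2 * n)) ℂ L)
    (p : ℙ ℂ (smoothSections (n := n) L)) (x : M) (w : TangentSpace (𝓡 (2 * n)) x) : ℂ :=
  inner ℂ ((p.rep : Π x : M, L x) x) (nabla (p.rep : Π x : M, L x) x w)
    / inner ℂ ((p.rep : Π x : M, L x) x) ((p.rep : Π x : M, L x) x)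

/-! ### Special Bohr-Sommerfeld Lagrangian submanifolds -/

section Cycles

variable {S₀ : Type u} [TopologicalSpace S₀] [ChartedSpace (EuclideanSpace ℝ (Fin n)) S₀]
  [IsManifold (𝓡 n) ∞ S₀]

/-- `i` is a Lagrangian embedding of the `n`-manifold `S₀`. -/
structure IsLagrangianEmbedding (Ω : SymplecticForm n M) (i : C(S₀, M)) : Prop where
  embedding : IsSmoothEmbedding (𝓡 n) (𝓡 (2 * n)) ∞ i
  isotropic : ∀ (s : S₀) (w w' : TangentSpace (𝓡 n) s),
    Ω.form (i s) (mfderiv (𝓡 n) (𝓡 (2 * n)) i s w) (mfderiv (𝓡 n) (𝓡 (2 * n)) i s w') = 0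

/-- `σ` is a nowhere vanishing smooth section of `i^* L`, covariantly constant for the pulled back
connection `i^* ∇`, which is given by
`(i^* ∇)_w (g • (τ ∘ i)) = dg(w) • τ ∘ i + g • ∇_{di(w)} τ`
for local functions `g` and sections `τ` of `L`. -/
structure IsParallelFrameAlong (nabla : CovariantDerivative (𝓡 (2 * n)) ℂ L) (i : C(S₀, M))
    (σ : Π s : S₀, L (i s)) : Prop where
  smooth : ContMDiff (𝓡 n) ((𝓡 (2 * n)).prod 𝓘(ℝ, ℂ)) ∞
    (fun s => (⟨i s, σ s⟩ : TotalSpace ℂ L))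
  ne_zero : ∀ s : S₀, σ s ≠ 0
  parallel : ∀ τ ∈ smoothSections (n := n) L, ∀ (g : S₀ → ℂ) (s : S₀),
    ContMDiffAt (𝓡 n) 𝓘(ℝ, ℂ) ∞ g s → (∀ᶠ s' in 𝓝 s, σ s' = g s' • τ (i s')) →
      ∀ w : TangentSpace (𝓡 n) s,
        (mvfderiv (𝓡 n) g s w) • τ (i s) + g s • nabla τ (i s) (mfderiv (𝓡 n) (𝓡 (2 * n)) i s w) = 0

/-- `B_S`: the set of Lagrangian submanifolds of `M` which are diffeomorphic to `S₀`, represent the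
homology class `κ` (the fundamental class of `S₀` being `o`), and satisfy the Bohr-Sommerfeld
condition. -/
def bohrSommerfeldCycles (Ω : SymplecticForm n M)
    (nabla : CovariantDerivative (𝓡 (2 * n)) ℂ L)
    (o : integralHomology n S₀) (κ : integralHomology n M) : Set (Set M) :=
  {S | ∃ i : C(S₀, M), IsLagrangianEmbedding Ω i ∧ Set.range i = S ∧
    integralHomologyMap n i o = κ ∧ ∃ σ : Π s : S₀, L (i s), IsParallelFrameAlong nabla i σ}

/-- The universal object `U_SBS(a)` in `ℙ Γ(M, L) × B_S`: pairs `([α], S)` such that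
`α|_S = e^{ic} f σ_S` with `σ_S` covariantly constant, `c` a real constant and `f` a strictly
positive smooth function on `S`. -/
def universalSBS (Ω : SymplecticForm n M) (nabla : CovariantDerivative (𝓡 (2 * n)) ℂ L)
    (o : integralHomology n S₀) (κ : integralHomology n M) :
    Set (ℙ ℂ (smoothSections (n := n) L) × Set M) :=
  {z | z.2 ∈ bohrSommerfeldCycles Ω nabla o κ ∧
    ∃ (α : smoothSections (n := n) L) (hα : α ≠ 0), Projectivization.mk ℂ α hα = z.1 ∧
      ∃ i : C(S₀, M), IsLagrangianEmbedding Ω i ∧ Set.range i = z.2 ∧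
        ∃ σ : Π s : S₀, L (i s), IsParallelFrameAlong nabla i σ ∧
          ∃ (c : ℝ) (f : S₀ → ℝ), ContMDiff (𝓡 n) 𝓘(ℝ, ℝ) ∞ f ∧ (∀ s, 0 < f s) ∧
            ∀ s, (α : Π x : M, L x) (i s) = (Complex.exp (Complex.I * c) * (f s : ℂ)) • σ s}

variable (S₀) in
/-- `Im ρ|_S = 0`: the pullback of `Im ρ` by every parametrization of `S` by `S₀` is zero. -/
def ImVanishesOn (ρ : ∀ x : M, TangentSpace (𝓡 (2 * n)) x → ℂ) (S : Set M) : Prop :=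
  ∀ i : C(S₀, M), IsSmoothEmbedding (𝓡 n) (𝓡 (2 * n)) ∞ i → Set.range i = S →
    ∀ (s : S₀) (w : TangentSpace (𝓡 n) s), (ρ (i s) (mfderiv (𝓡 n) (𝓡 (2 * n)) i s w)).im = 0

end Cycles

/-! ### The action of a Hamiltonian flow on `ℙ Γ(M, L)` -/

/-- A lift of `g : M → M` to the prequantum bundle: a smooth bundle map covering `g`, which is a
complex linear isometry of the fibres and preserves the connection. -/
structure PrequantumLift (nabla : CovariantDerivative (𝓡 (2 * n)) ℂ L) (g : M → M) where
  /-- the map between the fibres -/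
  map : ∀ x : M, L x ≃ₗᵢ[ℂ] L (g x)
  smooth : ContMDiff ((𝓡 (2 * n)).prod 𝓘(ℝ, ℂ)) ((𝓡 (2 * n)).prod 𝓘(ℝ, ℂ)) ∞
    (fun z : TotalSpace ℂ L => (⟨g z.1, map z.1 z.2⟩ : TotalSpace ℂ L))
  parallel : ∀ s ∈ smoothSections (n := n) L, ∀ t ∈ smoothSections (n := n) L,
    (∀ x, t (g x) = map x (s x)) → ∀ (x : M) (w : TangentSpace (𝓡 (2 * n)) x),
      nabla t (g x) (mfderiv (𝓡 (2 * n)) (𝓡 (2 * n)) g x w) = map x (nabla s x w)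

/-- `q = g(p)`: a representative of `q` is the image of a representative of `p` under a lift of `g`
to the prequantum bundle. -/
def IsTransported (nabla : CovariantDerivative (𝓡 (2 * n)) ℂ L) (g : M → M)
    (p q : ℙ ℂ (smoothSections (n := n) L)) : Prop :=
  ∃ (Φ : PrequantumLift nabla g) (α β : smoothSections (n := n) L) (hα : α ≠ 0) (hβ : β ≠ 0),
    Projectivization.mk ℂ α hα = p ∧ Projectivization.mk ℂ β hβ = q ∧
      ∀ x, (β : Π x : M, L x) (g x) = Φ.map x ((α : Π x : M, L x) x)

/-- `q` has the same zero set `D` as `p`, and its 1-form is the image under `g` of the 1-form of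
`p` on the complement of `D`: `ρ(q) = (g⁻¹)^* ρ(p)`. -/
def IsRhoTransported (nabla : CovariantDerivative (𝓡 (2 * n)) ℂ L) (g : M → M)
    (p q : ℙ ℂ (smoothSections (n := n) L)) : Prop :=
  zeroSet q = zeroSet p ∧ ∀ x ∉ zeroSet p, ∀ w : TangentSpace (𝓡 (2 * n)) x,
    rhoForm nabla q (g x) (mfderiv (𝓡 (2 * n)) (𝓡 (2 * n)) g x w) = rhoForm nabla p x w

end LineBundle

end

/-! The lift of the flow is written down explicitly. In a nonvanishing local section `s` the
connection is a complex 1-form θ with ∇s = θ s and dθ = 2πi Ω. Cartan's formula, Ω(X_F, ·) = dF and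
the invariance of F under its own flow give d ∫₀^τ θ(X_F)(φ^r x) dr = (φ^τ)^*θ − θ − 2πi τ dF
(`exists_flow_box`). Hence E = exp(−∫₀^τ θ(X_F) − 2πi τ F) satisfies dE/E = θ − (φ^τ)^*θ, which is
exactly the condition for s(x) ↦ E(x) s(φ^τ x) to preserve the connection (`nabla_flowTransport`).
This map is parallel transport along the flow line times the phase e^{−2πiτF}, so it does not depend
on the frame (`flowTransport_eq`) and is isometric (`norm_flowTransport`). By compactness one small
time works at all points, and composing N lifts of φ^{t/N} reaches every t (`nonempty_lift`). Two
lifts differ by a locally constant factor, hence by a constant on the connected manifold M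
(`exists_map_eq_smul`); so the class φ^t(p) is well defined.

A lift carries curvature to curvature, so φ^t is symplectic (`form_mfderiv`). It maps a parallel
frame over S to one over φ^t(S), and the image of α has the same c and f with respect to it. The
homology class is unchanged because r ↦ φ^{rt} is a homotopy from the identity to φ^t. This gives
(1).

For (2), α = e^{ic} f σ on S with σ parallel yields ρ(p)|_S = d log f, which is real
(`im_connForm`). A section with prescribed ρ solves a first order linear equation, so off D it is
determined up to one constant on every connected set (`exists_eq_smul_on`). This is used twice: on
φ^t(S), connected because S₀ is, where the constant a is absorbed by replacing c with c + arg a and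
f with |a| f; and on M∖D, when connected, which gives uniqueness since both sections vanish on D. -/

set_option linter.unusedSectionVars false

noncomputable section

/-! ### Globalising local sections by bump functions -/

section Extension

variable {m : ℕ} {M : Type u} [TopologicalSpace M] [T2Space M]
  [ChartedSpace (EuclideanSpace ℝ (Fin m)) M] [IsManifold (𝓡 m) ∞ M]
  {F : Type*} [NormedAddCommGroup F] [NormedSpace ℝ F] (V : M → Type v)
  [∀ x, AddCommGroup (V x)] [∀ x, Module ℝ (V x)] [∀ x, TopologicalSpace (V x)]
  [TopologicalSpace (TotalSpace F V)] [FiberBundle F V] [VectorBundle ℝ F V]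

/-- A section which is smooth near a point agrees near that point with a global smooth section. -/
theorem exists_global_section_eventuallyEq {U : Set M} {x : M} (hU : U ∈ 𝓝 x) {ι : Type*}
    (σ : ι → Π y : M, V y)
    (hσ : ∀ i, ∀ y ∈ U, ContMDiffAt (𝓡 m) ((𝓡 m).prod 𝓘(ℝ, F)) ∞
      (fun y => (⟨y, σ i y⟩ : TotalSpace F V)) y) :
    ∃ ψ : M → ℝ, ψ =ᶠ[𝓝 x] 1 ∧ ∀ i, ContMDiff (𝓡 m) ((𝓡 m).prod 𝓘(ℝ, F)) ∞
        (fun y => (⟨y, ψ y • σ i y⟩ : TotalSpace F V)) := by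
  obtain ⟨W, hWU, hWo, hxW⟩ := mem_nhds_iff.mp hU
  obtain ⟨f, -, hf⟩ := (SmoothBumpFunction.nhds_basis_tsupport (I := 𝓡 m) x).mem_iff.mp
    (hWo.mem_nhds hxW)
  refine ⟨f, f.eventuallyEq_one, fun i => ?_⟩
  exact ContMDiffOn.smul_section_of_tsupport (f.contMDiff.contMDiffOn) hWo hf
    (fun y hy => (hσ i y (hWU hy)).contMDiffWithinAt)

end Extension

/-! ### Complex lines and nonvanishing sections -/

section LineBundle

variable {n : ℕ} {M : Type u} [TopologicalSpace M]
  [ChartedSpace (EuclideanSpace ℝ (Fin (2 * n))) M] [IsManifold (𝓡 (2 * n)) ∞ M]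
  {L : M → Type v} [∀ x, NormedAddCommGroup (L x)] [∀ x, InnerProductSpace ℂ (L x)]
  [TopologicalSpace (TotalSpace ℂ L)] [FiberBundle ℂ L]
  [VectorBundle ℂ ℂ L] [VectorBundle ℝ ℂ L] [ContMDiffVectorBundle ∞ ℂ L (𝓡 (2 * n))]

/-- A trivialization identifies the fibre with ℂ, where one divides. -/
theorem exists_smul_eq_of_ne_zero {x : M} {s : L x} (hs : s ≠ 0) (v : L x) :
    ∃ c : ℂ, v = c • s := by
  let e := (trivializationAt ℂ L x).continuousLinearEquivAt ℂ x (mem_baseSet_trivializationAt ℂ L x)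
  have he : e s ≠ 0 := by simpa using hs
  refine ⟨e v / e s, e.injective ?_⟩
  rw [map_smul, smul_eq_mul, div_mul_cancel₀ _ he]

/-- In a Hermitian line the coefficient with respect to a nonzero vector is given by the Hermitian
product. -/
theorem inner_div_inner_smul {x : M} {s : L x} (hs : s ≠ 0) (v : L x) :
    ((inner ℂ s v : ℂ) / inner ℂ s s) • s = v := by
  obtain ⟨c, rfl⟩ := exists_smul_eq_of_ne_zero hs v
  rw [inner_smul_right, mul_div_cancel_right₀ _ (inner_self_ne_zero.mpr hs)]

/-- Global frames need not exist, but a local extension of a nonzero vector can be cut off. This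
lets all local computations use global smooth sections, the only ones for which the connection
axioms are stated. -/
theorem exists_smoothSection_ne_zero [T2Space M] (x : M) :
    ∃ s ∈ smoothSections (n := n) L, s x ≠ 0 := by
  obtain ⟨v, hv⟩ : ∃ v : L x, v ≠ 0 := by
    let e := (trivializationAt ℂ L x).continuousLinearEquivAt ℂ x
      (mem_baseSet_trivializationAt ℂ L x)
    exact ⟨e.symm 1, by simp⟩
  obtain ⟨U, hU, hs⟩ := FiberBundle.exists_contMDiffOn_extend (k := ∞) (𝓡 (2 * n)) ℂ v
  obtain ⟨W, hWU, hWo, hxW⟩ := mem_nhds_iff.mp hU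
  obtain ⟨ψ, h1, h2⟩ := exists_global_section_eventuallyEq (m := 2 * n) L (hWo.mem_nhds hxW)
    (fun _ : Unit => FiberBundle.extend ℂ v)
    (fun _ y hy => (hs.mono hWU).contMDiffAt (hWo.mem_nhds hy))
  refine ⟨_, h2 (), ?_⟩
  have := h1.eq_of_nhds
  simp [this, hv]

theorem smoothSection_mdifferentiableAt {s : Π x : M, L x} (hs : s ∈ smoothSections (n := n) L)
    (x : M) : MDifferentiableAt (𝓡 (2 * n)) ((𝓡 (2 * n)).prod 𝓘(ℝ, ℂ))
      (fun x => (⟨x, s x⟩ : TotalSpace ℂ L)) x :=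
  ContMDiffAt.mdifferentiableAt (n := ∞) (hs x) (by simp)

end LineBundle

/-! ### The connection form of a frame -/

section Connection

variable {n : ℕ} {M : Type u} [TopologicalSpace M]
  [ChartedSpace (EuclideanSpace ℝ (Fin (2 * n))) M] [IsManifold (𝓡 (2 * n)) ∞ M]
  {L : M → Type v} [∀ x, NormedAddCommGroup (L x)] [∀ x, InnerProductSpace ℂ (L x)]
  [TopologicalSpace (TotalSpace ℂ L)] [FiberBundle ℂ L]
  [VectorBundle ℂ ℂ L] [VectorBundle ℝ ℂ L] [ContMDiffVectorBundle ∞ ℂ L (𝓡 (2 * n))]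
  {nabla : CovariantDerivative (𝓡 (2 * n)) ℂ L}

theorem CovariantDerivative.congr_of_eventuallyEq {s t : Π x : M, L x} {x : M}
    (hs : MDifferentiableAt (𝓡 (2 * n)) ((𝓡 (2 * n)).prod 𝓘(ℝ, ℂ))
      (fun x => (⟨x, s x⟩ : TotalSpace ℂ L)) x)
    (hst : ∀ᶠ y in 𝓝 x, s y = t y) : nabla s x = nabla t x := by
  refine (nabla.isCovariantDerivativeOn (s := Set.univ)).congr_of_eventuallyEq hs ?_
    Filter.univ_mem hst
  refine hs.congr_of_eventuallyEq ?_
  filter_upwards [hst] with y hy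
  rw [hy]

variable {Ω : SymplecticForm n M}

/-- The Leibniz rule for complex functions. -/
theorem IsPrequantumConnection.leibniz (ha : IsPrequantumConnection Ω nabla) {s : Π x : M, L x}
    (hs : s ∈ smoothSections (n := n) L) {h : M → ℂ} {x : M}
    (hh : MDifferentiableAt (𝓡 (2 * n)) 𝓘(ℝ, ℂ) h x) (w : TangentSpace (𝓡 (2 * n)) x) :
    nabla (fun y => h y • s y) x w = mvfderiv (𝓡 (2 * n)) h x w • s x + h x • nabla s x w := by
  -- The covariant derivative satisfies the Leibniz rule only for real functions. Splitting h s =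
  -- (Re h) s + (Im h)(i s) and using complex linearity on the section i s gives the complex rule.
  have hIs : (Complex.I • s) ∈ smoothSections (n := n) L := Submodule.smul_mem _ _ hs
  have hre' : HasMFDerivAt (𝓡 (2 * n)) 𝓘(ℝ, ℝ) (fun y => (h y).re) x
      (Complex.reCLM.comp (mfderiv (𝓡 (2 * n)) 𝓘(ℝ, ℂ) h x)) :=
    (Complex.reCLM.hasMFDerivAt (x := h x)).comp x hh.hasMFDerivAt
  have him' : HasMFDerivAt (𝓡 (2 * n)) 𝓘(ℝ, ℝ) (fun y => (h y).im) x
      (Complex.imCLM.comp (mfderiv (𝓡 (2 * n)) 𝓘(ℝ, ℂ) h x)) :=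
    (Complex.imCLM.hasMFDerivAt (x := h x)).comp x hh.hasMFDerivAt
  have hre := hre'.mdifferentiableAt
  have him := him'.mdifferentiableAt
  have e : (fun y => h y • s y) =
      (fun y => (h y).re) • s + (fun y => (h y).im) • (Complex.I • s) := by
    funext y
    simp only [Pi.add_apply, Pi.smul_apply', Pi.smul_apply]
    conv_lhs => rw [← Complex.re_add_im (h y)]
    rw [add_smul, mul_smul]
    rfl
  have hsx := smoothSection_mdifferentiableAt hs x
  have hIx := smoothSection_mdifferentiableAt hIs x
  have hcov := nabla.isCovariantDerivativeOn (s := Set.univ)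
  have d1 : mvfderiv (𝓡 (2 * n)) (fun y => (h y).re) x w = (mvfderiv (𝓡 (2 * n)) h x w).re := by
    unfold mvfderiv
    rw [hre'.mfderiv]
    rfl
  have d2 : mvfderiv (𝓡 (2 * n)) (fun y => (h y).im) x w = (mvfderiv (𝓡 (2 * n)) h x w).im := by
    unfold mvfderiv
    rw [him'.mfderiv]
    rfl
  rw [e, hcov.add (MDifferentiableAt.smul_section hre hsx) (MDifferentiableAt.smul_section him hIx),
    hcov.leibniz hsx hre, hcov.leibniz hIx him]
  simp only [add_apply, smul_apply,
    ContinuousLinearMap.smulRight_apply, d1, d2, ha.complexLinear s hs, Pi.smul_apply]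
  have r : ∀ (z : ℂ) (v : L x), z • v = z.re • v + z.im • Complex.I • v := by
    intro z v
    conv_lhs => rw [← Complex.re_add_im z]
    rw [add_smul, mul_smul]
    rfl
  rw [r (h x), r (mvfderiv (𝓡 (2 * n)) h x w)]
  module

theorem IsPrequantumConnection.nabla_eq_of_eventuallyEq_smul (ha : IsPrequantumConnection Ω nabla)
    {s t : Π x : M, L x} (hs : s ∈ smoothSections (n := n) L)
    (ht : t ∈ smoothSections (n := n) L) {h : M → ℂ} {x : M}
    (hh : MDifferentiableAt (𝓡 (2 * n)) 𝓘(ℝ, ℂ) h x) (hst : ∀ᶠ y in 𝓝 x, t y = h y • s y)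
    (w : TangentSpace (𝓡 (2 * n)) x) :
    nabla t x w = mvfderiv (𝓡 (2 * n)) h x w • s x + h x • nabla s x w := by
  rw [CovariantDerivative.congr_of_eventuallyEq (smoothSection_mdifferentiableAt ht x) hst,
    ha.leibniz hs hh]

theorem IsPrequantumConnection.nabla_mem (ha : IsPrequantumConnection Ω nabla)
    {s : Π x : M, L x} (hs : s ∈ smoothSections (n := n) L)
    {X : Π x : M, TangentSpace (𝓡 (2 * n)) x} (hX : IsSmoothVectorField X) :
    (fun y => nabla s y (X y)) ∈ smoothSections (n := n) L := by
  have h := (ha.smooth.contMDiff.contMDiff (σ := s) hs.contMDiffOn)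
  rw [contMDiffOn_univ] at h
  exact h.clm_bundle_apply hX

variable (nabla) in
/-- The connection form `⟨s, ∇s⟩ / ⟨s, s⟩` of the connection with respect to the section `s`. -/
def connForm (s : Π x : M, L x) (x : M) (w : TangentSpace (𝓡 (2 * n)) x) : ℂ :=
  inner ℂ (s x) (nabla s x w) / inner ℂ (s x) (s x)

theorem connForm_smul {s : Π x : M, L x} {x : M} (hx : s x ≠ 0)
    (w : TangentSpace (𝓡 (2 * n)) x) : connForm nabla s x w • s x = nabla s x w :=
  inner_div_inner_smul hx _

theorem connForm_eq_of_eq_smul {s : Π x : M, L x} {x : M} (hx : s x ≠ 0)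
    {w : TangentSpace (𝓡 (2 * n)) x} {c : ℂ} (h : nabla s x w = c • s x) :
    connForm nabla s x w = c := by
  rw [connForm, h, inner_smul_right, mul_div_cancel_right₀ _ (inner_self_ne_zero.mpr hx)]

theorem contMDiffAt_complex_div {E H N : Type*} [NormedAddCommGroup E] [NormedSpace ℝ E]
    [TopologicalSpace H] {I : ModelWithCorners ℝ E H} [TopologicalSpace N] [ChartedSpace H N]
    {k : ℕ∞ω} {f g : N → ℂ} {x : N} (hf : ContMDiffAt I 𝓘(ℝ, ℂ) k f x)
    (hg : ContMDiffAt I 𝓘(ℝ, ℂ) k g x) (hx : g x ≠ 0) :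
    ContMDiffAt I 𝓘(ℝ, ℂ) k (fun y => f y / g y) x := by
  have h : ContDiffAt ℝ k (fun z : ℂ × ℂ => z.1 * z.2⁻¹) (f x, g x) :=
    contDiffAt_fst.mul (contDiffAt_snd.inv hx)
  simp only [div_eq_mul_inv]
  exact h.contMDiffAt.comp x (hf.prodMk_space hg)

theorem contMDiffAt_inner_div (hL : IsSmoothHermitian (n := n) L) {s t : Π x : M, L x}
    (hs : s ∈ smoothSections (n := n) L) (ht : t ∈ smoothSections (n := n) L) {x : M}
    (hx : s x ≠ 0) :
    ContMDiffAt (𝓡 (2 * n)) 𝓘(ℝ, ℂ) ∞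
      (fun y => (inner ℂ (s y) (t y) : ℂ) / inner ℂ (s y) (s y)) x :=
  contMDiffAt_complex_div (hL s hs t ht x) (hL s hs s hs x) (inner_self_ne_zero.mpr hx)

theorem eventually_ne_zero (hL : IsSmoothHermitian (n := n) L) {s : Π x : M, L x}
    (hs : s ∈ smoothSections (n := n) L) {x : M} (hx : s x ≠ 0) : ∀ᶠ y in 𝓝 x, s y ≠ 0 := by
  have := ((hL s hs s hs).continuous.continuousAt (x := x)).eventually_ne
    (inner_self_ne_zero.mpr hx)
  filter_upwards [this] with y hy
  exact inner_self_ne_zero.mp hy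

theorem IsPrequantumConnection.contMDiffAt_connForm (ha : IsPrequantumConnection Ω nabla)
    (hL : IsSmoothHermitian (n := n) L)
    {s : Π x : M, L x} (hs : s ∈ smoothSections (n := n) L)
    {X : Π x : M, TangentSpace (𝓡 (2 * n)) x} (hX : IsSmoothVectorField X) {x : M} (hx : s x ≠ 0) :
    ContMDiffAt (𝓡 (2 * n)) 𝓘(ℝ, ℂ) ∞ (fun y => connForm nabla s y (X y)) x :=
  contMDiffAt_inner_div hL hs (ha.nabla_mem hs hX) hx

/-- Change of frame. -/
theorem IsPrequantumConnection.connForm_of_eventuallyEq_smul (ha : IsPrequantumConnection Ω nabla)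
    {s t : Π x : M, L x} (hs : s ∈ smoothSections (n := n) L)
    (ht : t ∈ smoothSections (n := n) L) {h : M → ℂ} {x : M}
    (hh : MDifferentiableAt (𝓡 (2 * n)) 𝓘(ℝ, ℂ) h x) (hst : ∀ᶠ y in 𝓝 x, t y = h y • s y)
    (hx : t x ≠ 0) (w : TangentSpace (𝓡 (2 * n)) x) :
    mvfderiv (𝓡 (2 * n)) h x w = h x * (connForm nabla t x w - connForm nabla s x w) := by
  have htx := hst.self_of_nhds
  have hsx : s x ≠ 0 := fun h0 => hx (by rw [htx, h0, smul_zero])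
  have h1 := ha.nabla_eq_of_eventuallyEq_smul hs ht hh hst w
  rw [← connForm_smul hx, ← connForm_smul hsx, htx, smul_smul, smul_smul, ← add_smul] at h1
  have := smul_left_injective ℂ hsx h1
  -- With t = h s, comparing coefficients of `s x` gives h θ_t = dh + h θ_s.
  linear_combination -this

end Connection

/-! ### Pullbacks and fibre integrals of 1-forms in a vector space -/

section Calculus

variable {E : Type*} [NormedAddCommGroup E] [NormedSpace ℝ E]

/-- The derivative of the pullback of a 1-form. -/
theorem hasFDerivAt_pullback_form {G : Type*} [NormedAddCommGroup G] [NormedSpace ℝ G]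
    {A : E → E →L[ℝ] ℂ} {ψ : G → E} {p : G} {k : ℕ∞ω} (hk : 2 ≤ k)
    (hA : DifferentiableAt ℝ A (ψ p)) (hψ : ContDiffAt ℝ k ψ p) (u v : G) :
    fderiv ℝ (fun q => (A (ψ q)).comp (fderiv ℝ ψ q)) p u v
      = fderiv ℝ A (ψ p) (fderiv ℝ ψ p u) (fderiv ℝ ψ p v)
        + A (ψ p) (fderiv ℝ (fderiv ℝ ψ) p u v) := by
  have h1 : DifferentiableAt ℝ ψ p := hψ.differentiableAt (by
    rintro rfl; simp at hk)
  have h2 : DifferentiableAt ℝ (fderiv ℝ ψ) p :=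
    ((hψ.of_le hk).fderiv_right (m := 1) (by norm_num)).differentiableAt (by simp)
  have h3 := (hA.hasFDerivAt.comp p h1.hasFDerivAt).clm_comp h2.hasFDerivAt
  have h4 := h3.fderiv
  simp only [Function.comp_apply] at h4
  rw [h4]
  simp [add_comm]

/-- This is d(ψ^*A) = ψ^*(dA): the second derivative of ψ is symmetric and drops out on
antisymmetrising. -/
theorem fderiv_pullback_form_antisymm {G : Type*} [NormedAddCommGroup G] [NormedSpace ℝ G]
    {A : E → E →L[ℝ] ℂ} {ψ : G → E} {p : G} {k : ℕ∞ω} (hk : 2 ≤ k)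
    (hA : DifferentiableAt ℝ A (ψ p)) (hψ : ContDiffAt ℝ k ψ p) (u v : G) :
    fderiv ℝ (fun q => (A (ψ q)).comp (fderiv ℝ ψ q)) p u v
        - fderiv ℝ (fun q => (A (ψ q)).comp (fderiv ℝ ψ q)) p v u
      = fderiv ℝ A (ψ p) (fderiv ℝ ψ p u) (fderiv ℝ ψ p v)
        - fderiv ℝ A (ψ p) (fderiv ℝ ψ p v) (fderiv ℝ ψ p u) := by
  have hs : IsSymmSndFDerivAt ℝ ψ p := hψ.isSymmSndFDerivAt (by simpa using hk)
  rw [hasFDerivAt_pullback_form hk hA hψ, hasFDerivAt_pullback_form hk hA hψ, hs.eq u v]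
  ring

/-- The derivative of the fibre integral of a 1-form `B` on `ℝ × E`, when the mixed component of
`dB` does not depend on the first coordinate. -/
theorem hasFDerivAt_integral_form [FiniteDimensional ℝ E]
    {B : ℝ × E → (ℝ × E →L[ℝ] ℂ)} {J : Set ℝ} {P : Set E} (hJ : IsOpen J) (hJc : J.OrdConnected)
    (hP : IsOpen P) (hB : ContDiffOn ℝ 1 B (J ×ˢ P)) {lam : E →L[ℝ] ℂ} {y : E} (hy : y ∈ P)
    (hd : ∀ r ∈ J, ∀ w, fderiv ℝ B (r, y) (1, 0) (0, w) - fderiv ℝ B (r, y) (0, w) (1, 0) = lam w)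
    (h0 : (0 : ℝ) ∈ J) {τ : ℝ} (hτ : τ ∈ J) :
    HasFDerivAt (fun y => ∫ r in (0 : ℝ)..τ, B (r, y) (1, 0))
      ((B (τ, y)).comp (ContinuousLinearMap.inr ℝ ℝ E)
        - (B (0, y)).comp (ContinuousLinearMap.inr ℝ ℝ E) - τ • lam) y := by
  have hsub : Set.uIcc 0 τ ⊆ J := hJc.uIcc_subset h0 hτ
  have hopen : IsOpen (J ×ˢ P) := hJ.prod hP
  have hBd : ∀ r ∈ J, ∀ z ∈ P, HasFDerivAt B (fderiv ℝ B (r, z)) (r, z) := fun r hr z hz =>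
    ((hB.contDiffAt (hopen.mem_nhds ⟨hr, hz⟩)).differentiableAt (by simp)).hasFDerivAt
  have hDB : ContinuousOn (fderiv ℝ B) (J ×ˢ P) :=
    hB.continuousOn_fderiv_of_isOpen hopen le_rfl
  let ev : (ℝ × E →L[ℝ] ℂ) →L[ℝ] ℂ := ContinuousLinearMap.apply ℝ ℂ ((1 : ℝ), (0 : E))
  let F' : E → ℝ → E →L[ℝ] ℂ := fun z r =>
    (ev.comp (fderiv ℝ B (r, z))).comp (ContinuousLinearMap.inr ℝ ℝ E)
  have hF'c : ContinuousOn (fun q : ℝ × E => F' q.2 q.1) (J ×ˢ P) :=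
    (continuousOn_const.clm_comp hDB).clm_comp continuousOn_const
  -- The integrand's derivative is bounded on the compact product of the time interval and a closed
  -- ball, which gives the constant dominating function for differentiation under the integral.
  obtain ⟨δ, hδ, hball⟩ := Metric.nhds_basis_closedBall.mem_iff.mp (hP.mem_nhds hy)
  have hK : IsCompact (Set.uIcc 0 τ ×ˢ Metric.closedBall y δ) :=
    isCompact_uIcc.prod (isCompact_closedBall y δ)
  obtain ⟨b, hb⟩ := hK.exists_bound_of_continuousOn (hF'c.mono (Set.prod_mono hsub hball))
  have hcont : ∀ z ∈ P, ContinuousOn (fun r => B (r, z) (1, 0)) (Set.uIcc 0 τ) := fun z hz =>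
    ContinuousOn.clm_apply (hB.continuousOn.comp (by fun_prop) fun r hr => ⟨hsub hr, hz⟩)
      continuousOn_const
  have hF'y : ContinuousOn (F' y) (Set.uIcc 0 τ) :=
    hF'c.comp (f := fun r => (r, y)) (by fun_prop) fun r hr => ⟨hsub hr, hy⟩
  have key := intervalIntegral.hasFDerivAt_integral_of_dominated_of_fderiv_le
    (μ := MeasureTheory.volume) (𝕜 := ℝ) (F := fun z r => B (r, z) (1, 0)) (F' := F')
    (a := 0) (b := τ) (x₀ := y) (bound := fun _ => b)
    (Metric.closedBall_mem_nhds y hδ) ?_ (hcont y hy).intervalIntegrable ?_ ?_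
    intervalIntegrable_const ?_
  · refine key.congr_fderiv (ContinuousLinearMap.ext fun w => ?_)
    have hF'i : IntervalIntegrable (F' y) MeasureTheory.volume 0 τ := hF'y.intervalIntegrable
    rw [ContinuousLinearMap.intervalIntegral_apply hF'i]
    -- By hypothesis on dB, the derivative of the integrand in direction w is ∂_r(B(r, y)(0, w)) −
    -- λ(w); the first term integrates to boundary values.
    have e : ∀ r ∈ Set.uIcc 0 τ, F' y r w = fderiv ℝ B (r, y) (1, 0) (0, w) - lam w := by
      intro r hr
      rw [← hd r (hsub hr) w]
      simp [F', ev]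
    have hder : ∀ r ∈ Set.uIcc 0 τ, HasDerivAt (fun r => B (r, y) (0, w))
        (fderiv ℝ B (r, y) (1, 0) (0, w)) r := by
      intro r hr
      have h1 : HasDerivAt (fun r : ℝ => (r, y)) ((1 : ℝ), (0 : E)) r :=
        (hasDerivAt_id r).prodMk (hasDerivAt_const r y)
      have h2 := (hBd r (hsub hr) y hy).comp_hasDerivAt r h1
      simpa using h2.clm_apply (hasDerivAt_const r ((0 : ℝ), w))
    have hci : IntervalIntegrable (fun r => fderiv ℝ B (r, y) (1, 0) (0, w))
        MeasureTheory.volume 0 τ := by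
      apply ContinuousOn.intervalIntegrable
      have : ContinuousOn (fun r => fderiv ℝ B (r, y)) (Set.uIcc 0 τ) :=
        hDB.comp (f := fun r => (r, y)) (by fun_prop) fun r hr => ⟨hsub hr, hy⟩
      exact (this.clm_apply continuousOn_const).clm_apply continuousOn_const
    rw [intervalIntegral.integral_congr e, intervalIntegral.integral_sub hci
      intervalIntegrable_const, intervalIntegral.integral_eq_sub_of_hasDerivAt hder hci]
    simp
  · filter_upwards [hP.mem_nhds hy] with z hz
    exact ((hcont z hz).mono Set.uIoc_subset_uIcc).aestronglyMeasurable measurableSet_uIoc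
  · exact (hF'y.mono Set.uIoc_subset_uIcc).aestronglyMeasurable measurableSet_uIoc
  · refine Filter.Eventually.of_forall fun r hr z hz => hb (r, z) ⟨Set.uIoc_subset_uIcc hr, hz⟩
  · refine Filter.Eventually.of_forall fun r hr z hz => ?_
    have h1 : HasFDerivAt (fun z : E => (r, z)) (ContinuousLinearMap.inr ℝ ℝ E) z :=
      hasFDerivAt_prodMk_right r z
    exact (ev.hasFDerivAt.comp z
      ((hBd r (hsub (Set.uIoc_subset_uIcc hr)) z (hball hz)).comp z h1))

/-- The derivative found above involves only B at the two endpoints and λ, with no integral left. It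
is therefore smooth, and no repeated differentiation under the integral is needed. -/
theorem contDiffOn_integral_form [FiniteDimensional ℝ E]
    {B : ℝ × E → (ℝ × E →L[ℝ] ℂ)} {J : Set ℝ} {P : Set E} (hJ : IsOpen J) (hJc : J.OrdConnected)
    (hP : IsOpen P) (hB : ContDiffOn ℝ ∞ B (J ×ˢ P)) {lam : E → E →L[ℝ] ℂ}
    (hlam : ContDiffOn ℝ ∞ lam P)
    (hd : ∀ y ∈ P, ∀ r ∈ J, ∀ w,
      fderiv ℝ B (r, y) (1, 0) (0, w) - fderiv ℝ B (r, y) (0, w) (1, 0) = lam y w)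
    (h0 : (0 : ℝ) ∈ J) {τ : ℝ} (hτ : τ ∈ J) :
    ContDiffOn ℝ ∞ (fun y => ∫ r in (0 : ℝ)..τ, B (r, y) (1, 0)) P := by
  have hC := fun (y : E) (hy : y ∈ P) =>
    hasFDerivAt_integral_form hJ hJc hP (hB.of_le (by simp)) hy (hd y hy) h0 hτ
  rw [contDiffOn_infty_iff_fderiv_of_isOpen hP]
  refine ⟨fun z hz => (hC z hz).differentiableAt.differentiableWithinAt, ?_⟩
  have hBr : ∀ r ∈ J, ContDiffOn ℝ ∞ (fun z => (B (r, z)).comp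
      (ContinuousLinearMap.inr ℝ ℝ E)) P := by
    intro r hr
    have h1 : ContDiffOn ℝ ∞ (fun z : E => (r, z)) P :=
      (contDiff_const.prodMk contDiff_id).contDiffOn
    have h2 : ContDiffOn ℝ ∞ (fun z => B (r, z)) P := hB.comp h1 fun z hz => ⟨hr, hz⟩
    exact h2.clm_comp contDiffOn_const
  have hl : ContDiffOn ℝ ∞ (fun z => τ • lam z) P := hlam.const_smul τ
  exact (((hBr τ hτ).sub (hBr 0 h0)).sub hl).congr
    fun z hz => (hC z hz).fderiv

end Calculus

/-! ### Coordinate vector fields -/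

section Chart

variable {n : ℕ} {M : Type u} [TopologicalSpace M]
  [ChartedSpace (EuclideanSpace ℝ (Fin (2 * n))) M] [IsManifold (𝓡 (2 * n)) ∞ M]
  {L : M → Type v} [∀ x, NormedAddCommGroup (L x)] [∀ x, InnerProductSpace ℂ (L x)]
  [TopologicalSpace (TotalSpace ℂ L)] [FiberBundle ℂ L]
  [VectorBundle ℂ ℂ L] [VectorBundle ℝ ℂ L] [ContMDiffVectorBundle ∞ ℂ L (𝓡 (2 * n))]
  {nabla : CovariantDerivative (𝓡 (2 * n)) ℂ L} {Ω : SymplecticForm n M}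

variable (nabla) in
/-- `connForm` as a continuous linear form. -/
def connFormL (s : Π x : M, L x) (x : M) : TangentSpace (𝓡 (2 * n)) x →L[ℝ] ℂ where
  toFun := connForm nabla s x
  map_add' v w := by simp only [connForm, map_add, inner_add_right, add_div]
  map_smul' c v := by
    simp only [connForm, map_smul, RingHom.id_apply]
    rw [← Complex.coe_smul, inner_smul_right, Complex.real_smul, mul_div_assoc]
  cont := by
    unfold connForm
    have : Continuous fun w => (inner ℂ (s x) (nabla s x w) : ℂ) :=
      continuous_const.inner (nabla s x).continuous
    exact this.div_const _

/-- The coordinate vector field of the chart at `x₀` in the direction `v`. -/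
def coordField (x₀ : M) (v : EuclideanSpace ℝ (Fin (2 * n))) (x : M) :
    TangentSpace (𝓡 (2 * n)) x :=
  VectorField.mpullback (𝓡 (2 * n)) 𝓘(ℝ, EuclideanSpace ℝ (Fin (2 * n)))
    (extChartAt (𝓡 (2 * n)) x₀) (fun _ => v) x

theorem contMDiffAt_coordField (x₀ : M) (v : EuclideanSpace ℝ (Fin (2 * n))) {x : M}
    (hx : x ∈ (extChartAt (𝓡 (2 * n)) x₀).source) :
    ContMDiffAt (𝓡 (2 * n)) (𝓡 (2 * n)).tangent ∞
      (fun y => (⟨y, coordField x₀ v y⟩ : TangentBundle (𝓡 (2 * n)) M)) x := by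
  refine ContMDiffAt.mpullback_vectorField_preimage (n := ∞) (V := fun _ => v) ?_
    (contMDiffAt_extChartAt' (by simpa using hx)) (isInvertible_mfderiv_extChartAt hx) (by simp)
  exact (contMDiffAt_vectorSpace_iff_contDiffAt (V := fun _ => v)).mpr contDiffAt_const

theorem mvfderiv_coordField (x₀ : M) (v : EuclideanSpace ℝ (Fin (2 * n))) {x : M}
    (hx : x ∈ (extChartAt (𝓡 (2 * n)) x₀).source) :
    mvfderiv (𝓡 (2 * n)) (extChartAt (𝓡 (2 * n)) x₀) x (coordField x₀ v x) = v := by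
  have h := isInvertible_mfderiv_extChartAt (I := 𝓡 (2 * n)) hx
  exact congrArg (fun f => f v) h.self_comp_inverse

theorem coordField_mvfderiv (x₀ : M) {x : M}
    (hx : x ∈ (extChartAt (𝓡 (2 * n)) x₀).source) (w : TangentSpace (𝓡 (2 * n)) x) :
    coordField x₀ (mvfderiv (𝓡 (2 * n)) (extChartAt (𝓡 (2 * n)) x₀) x w) x = w := by
  have h := isInvertible_mfderiv_extChartAt (I := 𝓡 (2 * n)) hx
  exact congrArg (fun f => f w) h.inverse_comp_self

/-- The bracket commutes with pullback by the chart, and constant fields commute. -/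
theorem mlieBracket_coordField (x₀ : M) (v w : EuclideanSpace ℝ (Fin (2 * n))) {x : M}
    (hx : x ∈ (extChartAt (𝓡 (2 * n)) x₀).source) :
    VectorField.mlieBracket (𝓡 (2 * n)) (coordField x₀ v) (coordField x₀ w) x = 0 := by
  have hd : ∀ v : EuclideanSpace ℝ (Fin (2 * n)), MDifferentiableAt
      𝓘(ℝ, EuclideanSpace ℝ (Fin (2 * n))) 𝓘(ℝ, EuclideanSpace ℝ (Fin (2 * n))).tangent
      (fun y => (⟨y, v⟩ : TangentBundle 𝓘(ℝ, EuclideanSpace ℝ (Fin (2 * n)))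
        (EuclideanSpace ℝ (Fin (2 * n))))) (extChartAt (𝓡 (2 * n)) x₀ x) := fun v =>
    ((contMDiffAt_vectorSpace_iff_contDiffAt (n := 1) (V := fun _ => v)).mpr
      contDiffAt_const).mdifferentiableAt (by simp)
  have : IsManifold (𝓡 (2 * n)) (minSmoothness ℝ 2) M := by
    rw [minSmoothness_of_isRCLikeNormedField]
    exact IsManifold.of_le (n := ∞) (ENat.LEInfty.out)
  have h := VectorField.mpullback_mlieBracket (𝕜 := ℝ) (I := 𝓡 (2 * n))
    (I' := 𝓘(ℝ, EuclideanSpace ℝ (Fin (2 * n)))) (n := ∞)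
    (f := extChartAt (𝓡 (2 * n)) x₀) (hd v) (hd w)
    (contMDiffAt_extChartAt' (by simpa using hx))
    (by rw [minSmoothness_of_isRCLikeNormedField]; exact ENat.LEInfty.out)
  refine h.symm.trans ?_
  rw [VectorField.mpullback_apply]
  have e := congrFun (VectorField.mlieBracketWithin_eq_lieBracketWithin (𝕜 := ℝ)
    (E := EuclideanSpace ℝ (Fin (2 * n))) (V := fun _ => v) (W := fun _ => w) (s := Set.univ))
    (extChartAt (𝓡 (2 * n)) x₀ x)
  have e' := congrFun (VectorField.mlieBracketWithin_univ
    (I := 𝓘(ℝ, EuclideanSpace ℝ (Fin (2 * n)))) (V := fun _ => v) (W := fun _ => w))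
    (extChartAt (𝓡 (2 * n)) x₀ x)
  have : VectorField.lieBracketWithin ℝ (fun _ : EuclideanSpace ℝ (Fin (2 * n)) => v)
    (fun _ => w) Set.univ (extChartAt (𝓡 (2 * n)) x₀ x) = 0 := by
    simp [VectorField.lieBracketWithin]
  exact (congrArg _ ((e'.symm.trans e).trans this)).trans (map_zero _)

end Chart

/-! ### Connection form and curvature in a chart -/

section ChartForm

variable {n : ℕ} {M : Type u} [TopologicalSpace M]
  [ChartedSpace (EuclideanSpace ℝ (Fin (2 * n))) M] [IsManifold (𝓡 (2 * n)) ∞ M]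
  {L : M → Type v} [∀ x, NormedAddCommGroup (L x)] [∀ x, InnerProductSpace ℂ (L x)]
  [TopologicalSpace (TotalSpace ℂ L)] [FiberBundle ℂ L]
  [VectorBundle ℂ ℂ L] [VectorBundle ℝ ℂ L] [ContMDiffVectorBundle ∞ ℂ L (𝓡 (2 * n))]
  {nabla : CovariantDerivative (𝓡 (2 * n)) ℂ L} {Ω : SymplecticForm n M}

theorem extChartAt_hasMFDerivAt (x₀ : M) {x : M}
    (hx : x ∈ (extChartAt (𝓡 (2 * n)) x₀).source) :
    MDifferentiableAt (𝓡 (2 * n)) 𝓘(ℝ, EuclideanSpace ℝ (Fin (2 * n)))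
      (extChartAt (𝓡 (2 * n)) x₀) x :=
  (contMDiffAt_extChartAt' (n := 1) (by simpa using hx)).mdifferentiableAt (by simp)

theorem mvfderiv_comp_differentiable {N : Type*} {E H F G : Type*} [NormedAddCommGroup E]
    [NormedSpace ℝ E] [TopologicalSpace H] {I : ModelWithCorners ℝ E H} [TopologicalSpace N]
    [ChartedSpace H N] [NormedAddCommGroup F] [NormedSpace ℝ F] [NormedAddCommGroup G]
    [NormedSpace ℝ G] {f : N → F} {g : F → G} {x : N}
    (hg : DifferentiableAt ℝ g (f x)) (hf : MDifferentiableAt I 𝓘(ℝ, F) f x)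
    (w : TangentSpace I x) :
    mvfderiv I (fun y => g (f y)) x w = fderiv ℝ g (f x) (mvfderiv I f x w) := by
  have h := (hg.hasFDerivAt.hasMFDerivAt).comp x hf.hasMFDerivAt
  exact congrArg (fun l => l w) h.mfderiv

/-- The connection form and the curvature formula in a chart, near a point where the frame does not
vanish. -/
theorem IsPrequantumConnection.exists_local_form [T2Space M] (ha : IsPrequantumConnection Ω nabla)
    (hL : IsSmoothHermitian (n := n) L) {s : Π x : M, L x}
    (hs : s ∈ smoothSections (n := n) L) {x₀ : M} (hx₀ : s x₀ ≠ 0) :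
    ∃ (W : Set M) (A : EuclideanSpace ℝ (Fin (2 * n)) → EuclideanSpace ℝ (Fin (2 * n)) →L[ℝ] ℂ),
      IsOpen W ∧ x₀ ∈ W ∧ W ⊆ (extChartAt (𝓡 (2 * n)) x₀).source ∧ (∀ x ∈ W, s x ≠ 0) ∧
      (∀ x ∈ W, ContDiffAt ℝ ∞ A (extChartAt (𝓡 (2 * n)) x₀ x)) ∧
      (∀ x ∈ W, ∀ w : TangentSpace (𝓡 (2 * n)) x, connForm nabla s x w =
        A (extChartAt (𝓡 (2 * n)) x₀ x)
          (mvfderiv (𝓡 (2 * n)) (extChartAt (𝓡 (2 * n)) x₀) x w)) ∧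
      ∀ x ∈ W, ∀ v w : TangentSpace (𝓡 (2 * n)) x,
        fderiv ℝ A (extChartAt (𝓡 (2 * n)) x₀ x)
            (mvfderiv (𝓡 (2 * n)) (extChartAt (𝓡 (2 * n)) x₀) x v)
            (mvfderiv (𝓡 (2 * n)) (extChartAt (𝓡 (2 * n)) x₀) x w)
          - fderiv ℝ A (extChartAt (𝓡 (2 * n)) x₀ x)
            (mvfderiv (𝓡 (2 * n)) (extChartAt (𝓡 (2 * n)) x₀) x w)
            (mvfderiv (𝓡 (2 * n)) (extChartAt (𝓡 (2 * n)) x₀) x v)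
          = 2 * (Real.pi : ℂ) * Complex.I * (Ω.form x v w : ℂ) := by
  set κ := extChartAt (𝓡 (2 * n)) x₀ with hκ
  have hso : IsOpen κ.source := isOpen_extChartAt_source x₀
  -- A single cutoff serves all coordinate fields simultaneously, so one set `W` works for every
  -- direction v.
  obtain ⟨ψ, hψ1, hψ⟩ := exists_global_section_eventuallyEq (m := 2 * n)
    (fun x : M => TangentSpace (𝓡 (2 * n)) x) (extChartAt_source_mem_nhds (I := 𝓡 (2 * n)) x₀)
    (fun v => coordField x₀ v) (fun v y hy => contMDiffAt_coordField x₀ v hy)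
  obtain ⟨W, hW, hWo, hxW⟩ := eventually_nhds_iff.mp
    ((hψ1.and (eventually_ne_zero hL hs hx₀)).and (extChartAt_source_mem_nhds (I := 𝓡 (2 * n)) x₀))
  have hWs : W ⊆ κ.source := fun y hy => (hW y hy).2
  have hW0 : ∀ y ∈ W, s y ≠ 0 := fun y hy => (hW y hy).1.2
  let X : EuclideanSpace ℝ (Fin (2 * n)) → Π x : M, TangentSpace (𝓡 (2 * n)) x :=
    fun v y => ψ y • coordField x₀ v y
  have hX : ∀ v, IsSmoothVectorField (X v) := fun v => hψ v
  have hXW : ∀ y ∈ W, ∀ v, X v y = coordField x₀ v y := fun y hy v => by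
    have : ψ y = 1 := (hW y hy).1.1
    simp only [X, this, one_smul]
  -- The connection form pushed forward by the chart. Off the chart domain the inverses may be
  -- default values; `A` is used only at points κ(y) with y in `W`.
  let A : EuclideanSpace ℝ (Fin (2 * n)) → EuclideanSpace ℝ (Fin (2 * n)) →L[ℝ] ℂ := fun z =>
    (connFormL nabla s (κ.symm z)).comp
      (mfderiv (𝓡 (2 * n)) 𝓘(ℝ, EuclideanSpace ℝ (Fin (2 * n))) κ (κ.symm z)).inverse
  have hA : ∀ y ∈ W, ∀ v, connForm nabla s y (X v y) = A (κ y) v := by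
    intro y hy v
    rw [hXW y hy]
    change _ = connForm nabla s (κ.symm (κ y)) (coordField x₀ v (κ.symm (κ y)))
    rw [κ.left_inv (hWs hy)]
  have hAc : ∀ y ∈ W, ContDiffAt ℝ ∞ A (κ y) := by
    intro y hy
    have hO : IsOpen (κ.target ∩ κ.symm ⁻¹' W) :=
      (continuousOn_extChartAt_symm x₀).isOpen_inter_preimage (isOpen_extChartAt_target x₀) hWo
    have hyO : κ y ∈ κ.target ∩ κ.symm ⁻¹' W :=
      ⟨κ.map_source (hWs hy), by rw [Set.mem_preimage, κ.left_inv (hWs hy)]; exact hy⟩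
    refine ContDiffOn.contDiffAt (contDiffOn_clm_apply.mpr fun v => ?_) (hO.mem_nhds hyO)
    intro z hz
    refine ContDiffAt.contDiffWithinAt ?_
    rw [← contMDiffAt_iff_contDiffAt]
    have hsymm : ContMDiffAt 𝓘(ℝ, EuclideanSpace ℝ (Fin (2 * n))) (𝓡 (2 * n)) ∞ κ.symm z :=
      (contMDiffOn_extChartAt_symm x₀).contMDiffAt ((isOpen_extChartAt_target x₀).mem_nhds hz.1)
    have h1 := ha.contMDiffAt_connForm hL hs (hX v) (hW0 _ hz.2)
    refine (h1.comp z hsymm).congr_of_eventuallyEq ?_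
    filter_upwards [hO.mem_nhds hz] with u hu
    have := hA _ hu.2 v
    rw [κ.right_inv hu.1] at this
    exact this.symm
  refine ⟨W, A, hWo, hxW, hWs, hW0, hAc, ?_, ?_⟩
  · intro y hy w
    rw [← hA y hy, hXW y hy, coordField_mvfderiv x₀ (hWs hy)]
  · intro y hy v' w'
    set v := mvfderiv (𝓡 (2 * n)) κ y v' with hv
    set w := mvfderiv (𝓡 (2 * n)) κ y w' with hw
    have hXv : X v y = v' := by rw [hXW y hy, hv, coordField_mvfderiv x₀ (hWs hy)]
    have hXw : X w y = w' := by rw [hXW y hy, hw, coordField_mvfderiv x₀ (hWs hy)]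
    have hbr : VectorField.mlieBracket (𝓡 (2 * n)) (X v) (X w) y = 0 := by
      have h1 : ∀ v, X v =ᶠ[𝓝 y] coordField x₀ v := fun v => by
        filter_upwards [hWo.mem_nhds hy] with z hz using hXW z hz v
      rw [Filter.EventuallyEq.mlieBracket_vectorField_eq (h1 v) (h1 w),
        mlieBracket_coordField x₀ v w (hWs hy)]
    -- ∇_u ∇_{X_w} s = (∂_u A(w) + A(w) A(u)) s. For u = X_v the quadratic term is symmetric in v
    -- and w, so it cancels in the commutator and the curvature identity becomes dA = 2πi Ω.
    have hder : ∀ v w : EuclideanSpace ℝ (Fin (2 * n)), ∀ u : TangentSpace (𝓡 (2 * n)) y,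
        nabla (fun z => nabla s z (X w z)) y u
          = (fderiv ℝ A (κ y) (mvfderiv (𝓡 (2 * n)) κ y u) w
            + connForm nabla s y (X w y) * connForm nabla s y u) • s y := by
      intro v w u
      have hAd : DifferentiableAt ℝ (fun z => A z w) (κ y) :=
        ((hAc y hy).differentiableAt (by simp)).clm_apply (differentiableAt_const w)
      have hκd := extChartAt_hasMFDerivAt (n := n) x₀ (hWs hy)
      have hd : MDifferentiableAt (𝓡 (2 * n)) 𝓘(ℝ, ℂ) (fun z => A (κ z) w) y :=
        hAd.mdifferentiableAt.comp y hκd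
      rw [ha.nabla_eq_of_eventuallyEq_smul hs (ha.nabla_mem hs (hX w)) hd ?_ u,
        ← connForm_smul (hW0 y hy), smul_smul, ← add_smul, hA y hy,
        mvfderiv_comp_differentiable hAd hκd]
      · congr 2
        rw [fderiv_clm_apply ((hAc y hy).differentiableAt (by simp)) (differentiableAt_const w)]
        simp
      · filter_upwards [hWo.mem_nhds hy] with z hz
        rw [← hA z hz, connForm_smul (hW0 z hz)]
    have hcurv := ha.curvature (X v) (X w) (hX v) (hX w) s hs y
    rw [hbr, map_zero, sub_zero, hder v w, hder w v, hXv, hXw, ← sub_smul] at hcurv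
    have := smul_left_injective ℂ (hW0 y hy) hcurv
    rw [← this]
    ring

end ChartForm

/-! ### Hamiltonian flows and Cartan's formula -/

section Flow

variable {n : ℕ} {M : Type u} [TopologicalSpace M]
  [ChartedSpace (EuclideanSpace ℝ (Fin (2 * n))) M] [IsManifold (𝓡 (2 * n)) ∞ M]
  {L : M → Type v} [∀ x, NormedAddCommGroup (L x)] [∀ x, InnerProductSpace ℂ (L x)]
  [TopologicalSpace (TotalSpace ℂ L)] [FiberBundle ℂ L]
  [VectorBundle ℂ ℂ L] [VectorBundle ℝ ℂ L] [ContMDiffVectorBundle ∞ ℂ L (𝓡 (2 * n))]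
  {nabla : CovariantDerivative (𝓡 (2 * n)) ℂ L} {Ω : SymplecticForm n M} {F : M → ℝ}
  {φ : ℝ → M → M}

theorem Filter.EventuallyEq.mvfderiv_apply_eq {N : Type*} {E H G : Type*} [NormedAddCommGroup E]
    [NormedSpace ℝ E] [TopologicalSpace H] {I : ModelWithCorners ℝ E H} [TopologicalSpace N]
    [ChartedSpace H N] [NormedAddCommGroup G] [NormedSpace ℝ G] {f g : N → G} {x : N}
    (h : f =ᶠ[𝓝 x] g) (w : TangentSpace I x) : mvfderiv I f x w = mvfderiv I g x w :=
  congrArg (fun l : E →L[ℝ] G => l w) h.mfderiv_eq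

theorem form_hamiltonianVectorField (Ω : SymplecticForm n M) (F : M → ℝ) (x : M)
    (w : TangentSpace (𝓡 (2 * n)) x) :
    Ω.form x (hamiltonianVectorField Ω F x) w = mvfderiv (𝓡 (2 * n)) F x w :=
  congrArg (fun l => l w) (Ω.existsUnique_vector x (mvfderiv (𝓡 (2 * n)) F x)).choose_spec.1

namespace IsHamiltonianFlow

theorem contMDiff (hφ : IsHamiltonianFlow Ω F φ) (t : ℝ) :
    ContMDiff (𝓡 (2 * n)) (𝓡 (2 * n)) ∞ (φ t) :=
  hφ.smooth.comp (contMDiff_const.prodMk contMDiff_id)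

theorem mdifferentiableAt (hφ : IsHamiltonianFlow Ω F φ) (t : ℝ) (x : M) :
    MDifferentiableAt (𝓡 (2 * n)) (𝓡 (2 * n)) (φ t) x :=
  (hφ.contMDiff t).mdifferentiable (by simp) x

theorem neg_apply (hφ : IsHamiltonianFlow Ω F φ) (t : ℝ) (x : M) : φ (-t) (φ t x) = x := by
  rw [← hφ.add, neg_add_cancel, hφ.zero]

theorem apply_neg (hφ : IsHamiltonianFlow Ω F φ) (t : ℝ) (x : M) : φ t (φ (-t) x) = x := by
  rw [← hφ.add, add_neg_cancel, hφ.zero]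

/-- Derivative of a vector valued function along the flow. -/
theorem hasDerivAt_comp (hφ : IsHamiltonianFlow Ω F φ) {G : Type*} [NormedAddCommGroup G]
    [NormedSpace ℝ G] {f : M → G} {x : M} {t : ℝ}
    (hf : MDifferentiableAt (𝓡 (2 * n)) 𝓘(ℝ, G) f (φ t x)) :
    HasDerivAt (fun r => f (φ r x))
      (mvfderiv (𝓡 (2 * n)) f (φ t x) (hamiltonianVectorField Ω F (φ t x))) t := by
  have h := hf.hasMFDerivAt.comp t (hφ.integralCurve x t)
  have h2 : HasFDerivAt (fun r => f (φ r x)) ((mvfderiv (𝓡 (2 * n)) f (φ t x)).comp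
      ((1 : ℝ →L[ℝ] ℝ).smulRight (hamiltonianVectorField Ω F (φ t x)))) t := h.hasFDerivAt
  refine h2.hasDerivAt.congr_deriv ?_
  exact congrArg (mvfderiv (𝓡 (2 * n)) f (φ t x)) (one_smul ℝ _)

/-- Conservation of energy: the derivative along a flow line is Ω(X_F, X_F) = 0. -/
theorem apply_eq (hφ : IsHamiltonianFlow Ω F φ) (hF : ContMDiff (𝓡 (2 * n)) 𝓘(ℝ, ℝ) ∞ F) (t : ℝ)
    (x : M) : F (φ t x) = F x := by
  have h : ∀ r, HasDerivAt (fun r => F (φ r x)) 0 r := fun r => by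
    have := hφ.hasDerivAt_comp (f := F) (x := x) (t := r) (hF.mdifferentiable (by simp) _)
    rwa [← form_hamiltonianVectorField, Ω.alternating] at this
  have := is_const_of_deriv_eq_zero (fun r => (h r).differentiableAt) (fun r => (h r).deriv) t 0
  simpa [hφ.zero] using this

theorem mvfderiv_apply (hφ : IsHamiltonianFlow Ω F φ) (hF : ContMDiff (𝓡 (2 * n)) 𝓘(ℝ, ℝ) ∞ F)
    (t : ℝ) (x : M) (w : TangentSpace (𝓡 (2 * n)) x) :
    mvfderiv (𝓡 (2 * n)) F (φ t x) (mfderiv (𝓡 (2 * n)) (𝓡 (2 * n)) (φ t) x w)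
      = mvfderiv (𝓡 (2 * n)) F x w := by
  have h := mvfderiv_comp_apply x (hF.mdifferentiable (by simp) (φ t x)) (hφ.mdifferentiableAt t x) w
  have e : F ∘ φ t = F := funext fun y => hφ.apply_eq hF t y
  rw [e] at h
  exact h.symm

end IsHamiltonianFlow

/-- The logarithm of the holonomy along the flow with respect to the frame `s`. -/
def flowIntegral (nabla : CovariantDerivative (𝓡 (2 * n)) ℂ L) (Ω : SymplecticForm n M) (F : M → ℝ)
    (φ : ℝ → M → M) (s : Π x : M, L x) (τ : ℝ) (x : M) : ℂ :=
  ∫ r in (0 : ℝ)..τ, connForm nabla s (φ r x) (hamiltonianVectorField Ω F (φ r x))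

/-- Near every point and for small times, the flow stays in the domain of a frame, and the
derivative of the integral of the connection form along the flow is given by Cartan's formula. -/
theorem IsPrequantumConnection.exists_flow_box [T2Space M] (ha : IsPrequantumConnection Ω nabla)
    (hL : IsSmoothHermitian (n := n) L) (hφ : IsHamiltonianFlow Ω F φ)
    (hF : ContMDiff (𝓡 (2 * n)) 𝓘(ℝ, ℝ) ∞ F) {s : Π x : M, L x}
    (hs : s ∈ smoothSections (n := n) L) {x₀ : M} (hx₀ : s x₀ ≠ 0) :
    ∃ (V : Set M) (ε : ℝ), IsOpen V ∧ x₀ ∈ V ∧ 0 < ε ∧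
      (∀ r, |r| < ε → ∀ x ∈ V, s (φ r x) ≠ 0) ∧
      ∀ τ, |τ| < ε → ∀ x ∈ V,
        ContMDiffAt (𝓡 (2 * n)) 𝓘(ℝ, ℂ) ∞ (flowIntegral nabla Ω F φ s τ) x ∧
        ContinuousOn (fun r => connForm nabla s (φ r x) (hamiltonianVectorField Ω F (φ r x)))
          (Set.Ioo (-ε) ε) ∧
        ∀ w : TangentSpace (𝓡 (2 * n)) x,
          mvfderiv (𝓡 (2 * n)) (flowIntegral nabla Ω F φ s τ) x w
            = connForm nabla s (φ τ x) (mfderiv (𝓡 (2 * n)) (𝓡 (2 * n)) (φ τ) x w)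
              - connForm nabla s x w
              - τ * (2 * (Real.pi : ℂ) * Complex.I * (mvfderiv (𝓡 (2 * n)) F x w : ℂ)) := by
  obtain ⟨W, A, hWo, hxW, hWs, hW0, hAc, hAf, hAd⟩ := ha.exists_local_form hL hs hx₀
  set κ := extChartAt (𝓡 (2 * n)) x₀ with hκ
  -- Joint continuity of the flow at (0, x₀) provides the time and the neighbourhood for which flow
  -- lines stay in `W`.
  obtain ⟨ε, hε, V, hVo, hxV, hVW⟩ : ∃ ε > 0, ∃ V : Set M, IsOpen V ∧ x₀ ∈ V ∧
      ∀ r, |r| < ε → ∀ x ∈ V, φ r x ∈ W := by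
    have hc : ContinuousAt (fun z : ℝ × M => φ z.1 z.2) (0, x₀) :=
      hφ.smooth.continuous.continuousAt
    have hm : (fun z : ℝ × M => φ z.1 z.2) ⁻¹' W ∈ 𝓝 (0, x₀) :=
      hc.preimage_mem_nhds (by simpa [hφ.zero] using hWo.mem_nhds hxW)
    rw [nhds_prod_eq, Filter.mem_prod_iff] at hm
    obtain ⟨t₁, ht₁, t₂, ht₂, hsub⟩ := hm
    obtain ⟨ε, hε, hb⟩ := Metric.mem_nhds_iff.mp ht₁
    obtain ⟨V, hV, hVo, hxV⟩ := mem_nhds_iff.mp ht₂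
    exact ⟨ε, hε, V, hVo, hxV, fun r hr x hx =>
      hsub (Set.mk_mem_prod (hb (by simpa using hr)) (hV hx))⟩
  have hVW' : V ⊆ W := fun x hx => by
    have := hVW 0 (by simpa using hε) x hx
    rwa [hφ.zero] at this
  have hVs : V ⊆ κ.source := hVW'.trans hWs
  set J : Set ℝ := Set.Ioo (-ε) ε with hJ
  set P : Set (EuclideanSpace ℝ (Fin (2 * n))) := κ.target ∩ κ.symm ⁻¹' V with hP
  have hPo : IsOpen P :=
    (continuousOn_extChartAt_symm x₀).isOpen_inter_preimage (isOpen_extChartAt_target x₀) hVo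
  have hVP : ∀ x ∈ V, κ x ∈ P := fun x hx => ⟨κ.map_source (hVs hx), by
    rw [Set.mem_preimage, κ.left_inv (hVs hx)]; exact hx⟩
  let Ψ : ℝ × EuclideanSpace ℝ (Fin (2 * n)) → EuclideanSpace ℝ (Fin (2 * n)) :=
    fun q => κ (φ q.1 (κ.symm q.2))
  have hJP : IsOpen (J ×ˢ P) := isOpen_Ioo.prod hPo
  have hmem : ∀ q ∈ J ×ˢ P, φ q.1 (κ.symm q.2) ∈ W := fun q hq =>
    hVW q.1 (abs_lt.mpr hq.1) _ hq.2.2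
  have hsymm : ContMDiffOn 𝓘(ℝ, EuclideanSpace ℝ (Fin (2 * n))) (𝓡 (2 * n)) ∞ κ.symm P :=
    (contMDiffOn_extChartAt_symm x₀).mono fun z hz => hz.1
  have hΨ : ∀ q ∈ J ×ˢ P, ContDiffAt ℝ ∞ Ψ q := by
    intro q hq
    rw [← contMDiffAt_iff_contDiffAt]
    have h1 : ContMDiffAt 𝓘(ℝ, ℝ × EuclideanSpace ℝ (Fin (2 * n)))
        (𝓘(ℝ, ℝ).prod (𝓡 (2 * n))) ∞ (fun q => (q.1, κ.symm q.2)) q := by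
      refine ContMDiffAt.prodMk contDiffAt_fst.contMDiffAt ?_
      exact ((hsymm.contMDiffAt (hPo.mem_nhds hq.2)).comp q contDiffAt_snd.contMDiffAt)
    have h2 : ContMDiffAt (𝓡 (2 * n)) 𝓘(ℝ, EuclideanSpace ℝ (Fin (2 * n))) ∞ κ
        (φ q.1 (κ.symm q.2)) := contMDiffAt_extChartAt' (by simpa [hκ] using hWs (hmem q hq))
    exact h2.comp q ((hφ.smooth _).comp q h1)
  have hΨon : ContDiffOn ℝ ∞ Ψ (J ×ˢ P) := fun q hq => (hΨ q hq).contDiffWithinAt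
  -- B = Ψ^*A is the connection form pulled back to time × space. Its dr-component is the integrand
  -- of `flowIntegral`, its spatial component at time r is (φ^r)^*θ.
  let B : ℝ × EuclideanSpace ℝ (Fin (2 * n)) → (ℝ × EuclideanSpace ℝ (Fin (2 * n)) →L[ℝ] ℂ) :=
    fun q => (A (Ψ q)).comp (fderiv ℝ Ψ q)
  have hB : ContDiffOn ℝ ∞ B (J ×ˢ P) := by
    refine ContDiffOn.clm_comp (fun q hq => ?_) (hΨon.fderiv_of_isOpen hJP (by simp))
    exact ((hAc _ (hmem q hq)).comp q (hΨ q hq)).contDiffWithinAt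
  -- the partial derivatives of `Ψ`
  have hΨt : ∀ r ∈ J, ∀ x ∈ V, fderiv ℝ Ψ (r, κ x) (1, 0)
      = mvfderiv (𝓡 (2 * n)) κ (φ r x) (hamiltonianVectorField Ω F (φ r x)) := by
    intro r hr x hx
    have h1 : HasDerivAt (fun r : ℝ => (r, κ x)) ((1 : ℝ), (0 : EuclideanSpace ℝ (Fin (2 * n)))) r :=
      (hasDerivAt_id r).prodMk (hasDerivAt_const r (κ x))
    have h2 := ((hΨ (r, κ x) ⟨hr, hVP x hx⟩).differentiableAt
      (by simp)).hasFDerivAt.comp_hasDerivAt r h1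
    have h3 := hφ.hasDerivAt_comp (f := κ) (x := x) (t := r)
      (extChartAt_hasMFDerivAt x₀ (hWs (hVW r (abs_lt.mpr hr) x hx)))
    refine h2.unique ?_
    simpa only [Ψ, Function.comp_def, κ.left_inv (hVs hx)] using h3
  have hΨx : ∀ r ∈ J, ∀ x ∈ V, ∀ w : TangentSpace (𝓡 (2 * n)) x,
      fderiv ℝ Ψ (r, κ x) (0, mvfderiv (𝓡 (2 * n)) κ x w)
        = mvfderiv (𝓡 (2 * n)) κ (φ r x) (mfderiv (𝓡 (2 * n)) (𝓡 (2 * n)) (φ r) x w) := by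
    intro r hr x hx w
    have h1 : HasFDerivAt (fun z => (r, z)) (ContinuousLinearMap.inr ℝ ℝ _) (κ x) :=
      hasFDerivAt_prodMk_right r (κ x)
    have h2 : HasFDerivAt (fun z => Ψ (r, z)) _ (κ x) :=
      ((hΨ (r, κ x) ⟨hr, hVP x hx⟩).differentiableAt (by simp)).hasFDerivAt.comp (κ x) h1
    have h3 := (h2.hasMFDerivAt.comp x
      (extChartAt_hasMFDerivAt x₀ (hVs hx)).hasMFDerivAt).mfderiv
    have hκr := (extChartAt_hasMFDerivAt x₀ (hWs (hVW r (abs_lt.mpr hr) x hx))).hasMFDerivAt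
    have h4 := (hκr.comp x (hφ.mdifferentiableAt r x).hasMFDerivAt).mfderiv
    have h5 : ((fun z => Ψ (r, z)) ∘ κ) =ᶠ[𝓝 x] (κ ∘ φ r) := by
      filter_upwards [hVo.mem_nhds hx] with z hz
      simp only [Ψ, Function.comp_def, κ.left_inv (hVs hz)]
    rw [h5.mfderiv_eq] at h3
    exact congrArg (fun l => l w) (h3.symm.trans h4)
  have hBt : ∀ r ∈ J, ∀ x ∈ V, B (r, κ x) (1, 0)
      = connForm nabla s (φ r x) (hamiltonianVectorField Ω F (φ r x)) := by
    intro r hr x hx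
    rw [hAf _ (hVW r (abs_lt.mpr hr) x hx), ← hΨt r hr x hx]
    simp only [B, Ψ, κ.left_inv (hVs hx)]
    rfl
  have hBx : ∀ r ∈ J, ∀ x ∈ V, ∀ w : TangentSpace (𝓡 (2 * n)) x,
      B (r, κ x) (0, mvfderiv (𝓡 (2 * n)) κ x w)
        = connForm nabla s (φ r x) (mfderiv (𝓡 (2 * n)) (𝓡 (2 * n)) (φ r) x w) := by
    intro r hr x hx w
    rw [hAf _ (hVW r (abs_lt.mpr hr) x hx), ← hΨx r hr x hx]
    simp only [B, Ψ, κ.left_inv (hVs hx)]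
    rfl
  let Fc : EuclideanSpace ℝ (Fin (2 * n)) → ℝ := fun z => F (κ.symm z)
  have hFc : ContDiffOn ℝ ∞ Fc P := by
    rw [← contMDiffOn_iff_contDiffOn]
    exact hF.comp_contMDiffOn hsymm
  let lam : EuclideanSpace ℝ (Fin (2 * n)) → EuclideanSpace ℝ (Fin (2 * n)) →L[ℝ] ℂ := fun z =>
    (ContinuousLinearMap.toSpanSingleton ℝ (2 * (Real.pi : ℂ) * Complex.I)).comp (fderiv ℝ Fc z)
  have hlamV : ∀ x ∈ V, ∀ w : TangentSpace (𝓡 (2 * n)) x,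
      lam (κ x) (mvfderiv (𝓡 (2 * n)) κ x w)
        = 2 * (Real.pi : ℂ) * Complex.I * (mvfderiv (𝓡 (2 * n)) F x w : ℂ) := by
    intro x hx w
    have h1 := mvfderiv_comp_differentiable
      ((hFc.contDiffAt (hPo.mem_nhds (hVP x hx))).differentiableAt (by simp))
      (extChartAt_hasMFDerivAt x₀ (hVs hx)) w
    have h2 : (fun y => Fc (κ y)) =ᶠ[𝓝 x] F := by
      filter_upwards [hVo.mem_nhds hx] with z hz
      simp only [Fc, κ.left_inv (hVs hz)]
    have h3 := h2.mvfderiv_apply_eq w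
    rw [← h3]
    change _ = 2 * (Real.pi : ℂ) * Complex.I * (mvfderiv (𝓡 (2 * n)) (fun y => Fc (κ y)) x w : ℂ)
    rw [h1]
    simp only [lam, ContinuousLinearMap.comp_apply, ContinuousLinearMap.toSpanSingleton_apply,
      Complex.real_smul]
    ring
  have hlam : ContDiffOn ℝ ∞ lam P :=
    contDiffOn_const.clm_comp (hFc.fderiv_of_isOpen hPo (by simp))
  -- dB(∂_r, w) = 2πi Ω(X_F, dφ^r w) = 2πi dF(dφ^r w) = 2πi dF(w), independent of r. This is what
  -- makes the fibre integral computable.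
  have hcurv : ∀ z ∈ P, ∀ r ∈ J, ∀ w,
      fderiv ℝ B (r, z) (1, 0) (0, w) - fderiv ℝ B (r, z) (0, w) (1, 0) = lam z w := by
    intro z hz r hr w
    set x := κ.symm z with hx
    have hxV : x ∈ V := hz.2
    have hκx : κ x = z := κ.right_inv hz.1
    have hφW := hVW r (abs_lt.mpr hr) x hxV
    obtain ⟨w', rfl⟩ : ∃ w' : TangentSpace (𝓡 (2 * n)) x, mvfderiv (𝓡 (2 * n)) κ x w' = w :=
      ⟨coordField x₀ w x, mvfderiv_coordField x₀ w (hVs hxV)⟩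
    have hΨz : Ψ (r, z) = κ (φ r x) := rfl
    have hd : DifferentiableAt ℝ A (Ψ (r, z)) := by
      rw [hΨz]; exact (hAc _ hφW).differentiableAt (by simp)
    rw [fderiv_pullback_form_antisymm (k := ∞) ENat.LEInfty.out hd (hΨ (r, z) ⟨hr, hz⟩), hΨz, ← hκx,
      hlamV x hxV, hΨt r hr x hxV, hΨx r hr x hxV, hAd _ hφW, form_hamiltonianVectorField,
      hφ.mvfderiv_apply hF]
  have hC : ∀ τ ∈ J, ∀ z ∈ P, HasFDerivAt (fun z => ∫ r in (0 : ℝ)..τ, B (r, z) (1, 0))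
      ((B (τ, z)).comp (ContinuousLinearMap.inr ℝ ℝ _)
        - (B (0, z)).comp (ContinuousLinearMap.inr ℝ ℝ _) - τ • lam z) z := fun τ hτ z hz =>
    hasFDerivAt_integral_form isOpen_Ioo Set.ordConnected_Ioo hPo (hB.of_le (by simp)) hz
      (hcurv z hz) ⟨by linarith, hε⟩ hτ
  have hCs : ∀ τ ∈ J, ContDiffOn ℝ ∞ (fun z => ∫ r in (0 : ℝ)..τ, B (r, z) (1, 0)) P := fun τ hτ =>
    contDiffOn_integral_form isOpen_Ioo Set.ordConnected_Ioo hPo hB hlam hcurv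
      ⟨by linarith, hε⟩ hτ
  have hint : ∀ τ ∈ J, ∀ x ∈ V, flowIntegral nabla Ω F φ s τ x
      = ∫ r in (0 : ℝ)..τ, B (r, κ x) (1, 0) := by
    intro τ hτ x hx
    refine intervalIntegral.integral_congr fun r hr => (hBt r ?_ x hx).symm
    exact Set.ordConnected_Ioo.uIcc_subset ⟨by linarith, hε⟩ hτ hr
  refine ⟨V, ε, hVo, hxV, hε, fun r hr x hx => hW0 _ (hVW r hr x hx), fun τ hτ' x hx => ?_⟩
  have hτ : τ ∈ J := abs_lt.mp hτ'
  have hev : flowIntegral nabla Ω F φ s τ =ᶠ[𝓝 x]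
      fun x => ∫ r in (0 : ℝ)..τ, B (r, κ x) (1, 0) := by
    filter_upwards [hVo.mem_nhds hx] with y hy using hint τ hτ y hy
  refine ⟨?_, ?_, fun w => ?_⟩
  · refine ContMDiffAt.congr_of_eventuallyEq ?_ hev
    exact ((hCs τ hτ).contDiffAt (hPo.mem_nhds (hVP x hx))).contMDiffAt.comp x
      (contMDiffAt_extChartAt' (by simpa [hκ] using hVs hx))
  · refine ContinuousOn.congr ?_ fun r hr => (hBt r hr x hx).symm
    exact (hB.continuousOn.comp (f := fun r => (r, κ x)) (by fun_prop)
      fun r hr => ⟨hr, hVP x hx⟩).clm_apply continuousOn_const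
  · have h1 : mvfderiv (𝓡 (2 * n)) (flowIntegral nabla Ω F φ s τ) x w =
        mvfderiv (𝓡 (2 * n)) (fun x => ∫ r in (0 : ℝ)..τ, B (r, κ x) (1, 0)) x w :=
      hev.mvfderiv_apply_eq w
    have h0 := hBx 0 ⟨by linarith, hε⟩ x hx w
    -- The lower endpoint contributes θ itself, because φ⁰ is the identity.
    have hid : φ 0 = id := funext hφ.zero
    have h2 : connForm nabla s (φ 0 x) (mfderiv (𝓡 (2 * n)) (𝓡 (2 * n)) (φ 0) x w)
        = connForm nabla s x w := by
      rw [hid, mfderiv_id]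
      rfl
    rw [h1, mvfderiv_comp_differentiable (hC τ hτ _ (hVP x hx)).differentiableAt
      (extChartAt_hasMFDerivAt x₀ (hVs hx)), (hC τ hτ _ (hVP x hx)).fderiv, ← hlamV x hx,
      ← hBx τ hτ x hx, ← h2, ← h0]
    simp

end Flow

/-! ### A scalar linear differential equation -/

section LinearODE

/-- The solution of a scalar linear differential equation on an interval. -/
theorem eq_mul_exp_integral_of_hasDerivAt {h g : ℝ → ℂ} {τ : ℝ}
    (hg : ContinuousOn g (Set.uIcc 0 τ))
    (hh : ∀ r ∈ Set.uIcc 0 τ, HasDerivAt h (h r * g r) r) :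
    h τ = h 0 * Complex.exp (∫ r in (0 : ℝ)..τ, g r) := by
  -- Extending g continuously to the whole line makes its primitive differentiable at the endpoints
  -- too.
  obtain ⟨G, hG, hGg⟩ : ∃ G : ℝ → ℂ, Continuous G ∧ Set.EqOn G g (Set.uIcc 0 τ) := by
    rw [Set.uIcc] at hg ⊢
    refine ⟨Set.IccExtend (inf_le_sup (a := (0 : ℝ)) (b := τ)) (Set.domRestrict _ g),
      (continuousOn_iff_continuous_domRestrict.mp hg).Icc_extend', fun r hr => ?_⟩
    rw [Set.IccExtend_of_mem _ _ hr]
    rfl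
  -- The constancy argument below needs unique derivatives, hence a nondegenerate interval.
  rcases eq_or_ne 0 τ with rfl | h0
  · simp
  rw [intervalIntegral.integral_congr hGg.symm]
  have hI : ∀ r, HasDerivAt (fun r => ∫ u in (0 : ℝ)..r, G u) (G r) r := fun r =>
    intervalIntegral.integral_hasDerivAt_right (hG.intervalIntegrable _ _)
      (hG.stronglyMeasurableAtFilter _ _) hG.continuousAt
  have hQ : ∀ r ∈ Set.uIcc 0 τ,
      HasDerivAt (fun r => h r * Complex.exp (-∫ u in (0 : ℝ)..r, G u)) 0 r := by
    intro r hr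
    refine ((hh r hr).mul (hI r).neg.cexp).congr_deriv ?_
    rw [hGg hr]
    ring
  have hc := (convex_uIcc (0 : ℝ) τ).is_const_of_fderivWithin_eq_zero (𝕜 := ℝ)
    (f := fun r => h r * Complex.exp (-∫ u in (0 : ℝ)..r, G u))
    (fun r hr => (hQ r hr).differentiableAt.differentiableWithinAt) (fun r hr => ?_)
    Set.right_mem_uIcc Set.left_mem_uIcc
  · simp only [intervalIntegral.integral_same, neg_zero, Complex.exp_zero, mul_one] at hc
    rw [← hc, mul_assoc, ← Complex.exp_add]
    simp
  · have hu : UniqueDiffOn ℝ (Set.uIcc 0 τ) :=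
      uniqueDiffOn_Icc (by rcases lt_or_gt_of_ne h0 with h | h <;> simp [h])
    have hz : HasFDerivAt (fun r => h r * Complex.exp (-∫ u in (0 : ℝ)..r, G u))
        (0 : ℝ →L[ℝ] ℂ) r := by
      simpa using (hQ r hr).hasFDerivAt
    exact hz.hasFDerivWithinAt.fderivWithin (hu r hr)

end LinearODE

/-! ### Smoothness of multiples and coefficients in the line bundle -/

section Smoothness

variable {n : ℕ} {M : Type u} [TopologicalSpace M]
  [ChartedSpace (EuclideanSpace ℝ (Fin (2 * n))) M] [IsManifold (𝓡 (2 * n)) ∞ M]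
  {L : M → Type v} [∀ x, NormedAddCommGroup (L x)] [∀ x, InnerProductSpace ℂ (L x)]
  [TopologicalSpace (TotalSpace ℂ L)] [FiberBundle ℂ L]
  [VectorBundle ℂ ℂ L] [VectorBundle ℝ ℂ L] [ContMDiffVectorBundle ∞ ℂ L (𝓡 (2 * n))]

theorem contMDiffAt_complex_smul {E H N : Type*} [NormedAddCommGroup E] [NormedSpace ℝ E]
    [TopologicalSpace H] {I : ModelWithCorners ℝ E H} [TopologicalSpace N] [ChartedSpace H N]
    {k : ℕ∞ω} {b : N → M} {σ : Π z : N, L (b z)} {h : N → ℂ} {z : N}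
    (hσ : ContMDiffAt I ((𝓡 (2 * n)).prod 𝓘(ℝ, ℂ)) k
      (fun z => (⟨b z, σ z⟩ : TotalSpace ℂ L)) z)
    (hh : ContMDiffAt I 𝓘(ℝ, ℂ) k h z) :
    ContMDiffAt I ((𝓡 (2 * n)).prod 𝓘(ℝ, ℂ)) k
      (fun z => (⟨b z, h z • σ z⟩ : TotalSpace ℂ L)) z := by
  rw [contMDiffAt_totalSpace] at hσ ⊢
  refine ⟨hσ.1, ?_⟩
  have h2 : ContMDiffAt I 𝓘(ℝ, ℂ) k
      (fun y => h y * (trivializationAt ℂ L (b z) ⟨b y, σ y⟩).2) z := by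
    have hm : ContDiff ℝ k (fun z : ℂ × ℂ => z.1 * z.2) := contDiff_fst.mul contDiff_snd
    exact hm.contMDiff.contMDiffAt.comp z (hh.prodMk_space hσ.2)
  refine h2.congr_of_eventuallyEq ?_
  have := hσ.1.continuousAt.preimage_mem_nhds ((trivializationAt ℂ L (b z)).open_baseSet.mem_nhds
    (mem_baseSet_trivializationAt ℂ L (b z)))
  filter_upwards [this] with y hy
  exact ((trivializationAt ℂ L (b z)).linear ℂ hy).map_smul (h y) (σ y)

/-- The coefficient with respect to a frame is a smooth function on the total space. -/
theorem contMDiffAt_coefficient {s : Π x : M, L x} (hs : s ∈ smoothSections (n := n) L)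
    {z : TotalSpace ℂ L} (hz : s z.1 ≠ 0) :
    ContMDiffAt ((𝓡 (2 * n)).prod 𝓘(ℝ, ℂ)) 𝓘(ℝ, ℂ) ∞
      (fun z : TotalSpace ℂ L => (inner ℂ (s z.1) z.2 : ℂ) / inner ℂ (s z.1) (s z.1)) z := by
  have hp : ContMDiffAt ((𝓡 (2 * n)).prod 𝓘(ℝ, ℂ)) (𝓡 (2 * n)) ∞
      (fun z : TotalSpace ℂ L => z.1) z := contMDiff_proj L z
  have h1 := (contMDiffAt_totalSpace.mp
    (contMDiffAt_id (I := (𝓡 (2 * n)).prod 𝓘(ℝ, ℂ)) (n := ∞) (x := z))).2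
  have h2 := (contMDiffAt_totalSpace.mp ((hs z.1).comp z hp)).2
  simp only [Function.comp_def, id] at h1 h2
  have hb := mem_baseSet_trivializationAt ℂ L z.1
  have key : ∀ y : M, y ∈ (trivializationAt ℂ L z.1).baseSet → s y ≠ 0 →
      (trivializationAt ℂ L z.1 ⟨y, s y⟩).2 ≠ 0 := by
    intro y hy h0 h
    apply h0
    let e := (trivializationAt ℂ L z.1).continuousLinearEquivAt ℂ y hy
    have : e (s y) = 0 := h
    simpa using this
  -- The quotient of Hermitian products equals the quotient of the coordinates in a trivialization,
  -- and those are smooth on the total space.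
  refine (contMDiffAt_complex_div h1 h2 (key _ hb hz)).congr_of_eventuallyEq ?_
  have hev : ∀ᶠ y in 𝓝 z, (trivializationAt ℂ L z.1 ⟨y.1, s y.1⟩).2 ≠ 0 :=
    h2.continuousAt.eventually_ne (key _ hb hz)
  have hbs := hp.continuousAt.preimage_mem_nhds
    ((trivializationAt ℂ L z.1).open_baseSet.mem_nhds hb)
  filter_upwards [hev, hbs] with y hy hyb
  have hsy : s y.1 ≠ 0 := by
    intro h
    apply hy
    let e := (trivializationAt ℂ L z.1).continuousLinearEquivAt ℂ y.1 hyb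
    change e (s y.1) = 0
    rw [h, map_zero]
  obtain ⟨c, hc⟩ := exists_smul_eq_of_ne_zero hsy y.2
  have h3 : (trivializationAt ℂ L z.1 y).2 = c * (trivializationAt ℂ L z.1 ⟨y.1, s y.1⟩).2 := by
    have := ((trivializationAt ℂ L z.1).linear ℂ hyb).map_smul c (s y.1)
    rw [← hc] at this
    exact this
  rw [h3, hc, inner_smul_right, mul_div_cancel_right₀ _ (inner_self_ne_zero.mpr hsy),
    mul_div_cancel_right₀ _ hy]

end Smoothness

/-! ### The lift for small times -/

section SmallTime

variable {n : ℕ} {M : Type u} [TopologicalSpace M]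
  [ChartedSpace (EuclideanSpace ℝ (Fin (2 * n))) M] [IsManifold (𝓡 (2 * n)) ∞ M]
  {L : M → Type v} [∀ x, NormedAddCommGroup (L x)] [∀ x, InnerProductSpace ℂ (L x)]
  [TopologicalSpace (TotalSpace ℂ L)] [FiberBundle ℂ L]
  [VectorBundle ℂ ℂ L] [VectorBundle ℝ ℂ L] [ContMDiffVectorBundle ∞ ℂ L (𝓡 (2 * n))]
  {nabla : CovariantDerivative (𝓡 (2 * n)) ℂ L} {Ω : SymplecticForm n M} {F : M → ℝ}
  {φ : ℝ → M → M}

/-- The smooth section `s` is a frame along the flow lines of length `τ` which start in `V`. -/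
structure IsFlowFrame (nabla : CovariantDerivative (𝓡 (2 * n)) ℂ L) (Ω : SymplecticForm n M)
    (F : M → ℝ) (φ : ℝ → M → M) (τ : ℝ) (s : Π x : M, L x) (V : Set M) : Prop where
  isOpen : IsOpen V
  mem : s ∈ smoothSections (n := n) L
  ne_zero : ∀ x ∈ V, ∀ r ∈ Set.uIcc 0 τ, s (φ r x) ≠ 0
  continuousOn : ∀ x ∈ V, ContinuousOn
    (fun r => connForm nabla s (φ r x) (hamiltonianVectorField Ω F (φ r x))) (Set.uIcc 0 τ)
  contMDiffAt : ∀ x ∈ V, ContMDiffAt (𝓡 (2 * n)) 𝓘(ℝ, ℂ) ∞ (flowIntegral nabla Ω F φ s τ) x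
  mvfderiv_eq : ∀ x ∈ V, ∀ w : TangentSpace (𝓡 (2 * n)) x,
    mvfderiv (𝓡 (2 * n)) (flowIntegral nabla Ω F φ s τ) x w
      = connForm nabla s (φ τ x) (mfderiv (𝓡 (2 * n)) (𝓡 (2 * n)) (φ τ) x w)
        - connForm nabla s x w
        - τ * (2 * (Real.pi : ℂ) * Complex.I * (mvfderiv (𝓡 (2 * n)) F x w : ℂ))

/-- A finite subcover by flow boxes has a least time ε; the frame is still allowed to vary with the
point. -/
theorem IsPrequantumConnection.exists_flowFrame [T2Space M] [CompactSpace M]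
    (ha : IsPrequantumConnection Ω nabla) (hL : IsSmoothHermitian (n := n) L)
    (hφ : IsHamiltonianFlow Ω F φ) (hF : ContMDiff (𝓡 (2 * n)) 𝓘(ℝ, ℝ) ∞ F) :
    ∃ ε > 0, ∀ τ, |τ| < ε → ∀ x : M, ∃ s V, x ∈ V ∧ IsFlowFrame nabla Ω F φ τ s V := by
  have h : ∀ x₀ : M, ∃ (s : Π x : M, L x) (V : Set M) (ε : ℝ), IsOpen V ∧ x₀ ∈ V ∧ 0 < ε ∧
      ∀ τ, |τ| < ε → IsFlowFrame nabla Ω F φ τ s V := by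
    intro x₀
    obtain ⟨s, hs, hs0⟩ := exists_smoothSection_ne_zero (n := n) (L := L) x₀
    obtain ⟨V, ε, hV, hxV, hε, hne, hVε⟩ := ha.exists_flow_box hL hφ hF hs hs0
    refine ⟨s, V, ε, hV, hxV, hε, fun τ hτ => ?_⟩
    have hsub : Set.uIcc 0 τ ⊆ Set.Ioo (-ε) ε :=
      Set.ordConnected_Ioo.uIcc_subset ⟨by linarith, hε⟩ (abs_lt.mp hτ)
    exact ⟨hV, hs, fun x hx r hr => hne r (abs_lt.mpr (hsub hr)) x hx,
      fun x hx => (hVε τ hτ x hx).2.1.mono hsub, fun x hx => (hVε τ hτ x hx).1,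
      fun x hx => (hVε τ hτ x hx).2.2⟩
  choose s V ε hV hxV hε hfr using h
  obtain ⟨T, hT⟩ := isCompact_univ.elim_finite_subcover V hV
    (fun x _ => Set.mem_iUnion.mpr ⟨x, hxV x⟩)
  obtain ⟨δ, hδ, hδT⟩ : ∃ δ > 0, ∀ i ∈ T, δ ≤ ε i := by
    rcases T.eq_empty_or_nonempty with rfl | hne
    -- No boxes are needed only if M is empty, and then any positive number will do.
    · exact ⟨1, one_pos, by simp⟩
    · obtain ⟨i, hi, hmin⟩ := T.exists_min_image ε hne
      exact ⟨ε i, hε i, hmin⟩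
  refine ⟨δ, hδ, fun τ hτ x => ?_⟩
  obtain ⟨i, hi, hxi⟩ := Set.mem_iUnion₂.mp (hT (Set.mem_univ x))
  exact ⟨s i, V i, hxi, hfr i τ (hτ.trans_le (hδT i hi))⟩

/-- The factor by which the lift of the flow differs from the identity in the frame `s`. -/
def flowFactor (nabla : CovariantDerivative (𝓡 (2 * n)) ℂ L) (Ω : SymplecticForm n M)
    (F : M → ℝ) (φ : ℝ → M → M) (s : Π x : M, L x) (τ : ℝ) (x : M) : ℂ :=
  Complex.exp (-flowIntegral nabla Ω F φ s τ x - τ * (2 * (Real.pi : ℂ) * Complex.I * (F x : ℂ)))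

/-- The lift of the flow expressed in the frame `s`. -/
def flowTransport (nabla : CovariantDerivative (𝓡 (2 * n)) ℂ L) (Ω : SymplecticForm n M)
    (F : M → ℝ) (φ : ℝ → M → M) (s : Π x : M, L x) (τ : ℝ) (x : M) (v : L x) : L (φ τ x) :=
  (flowFactor nabla Ω F φ s τ x * ((inner ℂ (s x) v : ℂ) / inner ℂ (s x) (s x))) • s (φ τ x)

namespace IsFlowFrame

variable {τ : ℝ} {s t : Π x : M, L x} {V W : Set M}

theorem ne_zero_left (hφ : IsHamiltonianFlow Ω F φ) (h : IsFlowFrame nabla Ω F φ τ s V) {x : M}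
    (hx : x ∈ V) : s x ≠ 0 := by
  have := h.ne_zero x hx 0 Set.left_mem_uIcc
  rwa [hφ.zero] at this

/-- The lift does not depend on the frame. -/
theorem flowTransport_eq (ha : IsPrequantumConnection Ω nabla) (hL : IsSmoothHermitian (n := n) L)
    (hφ : IsHamiltonianFlow Ω F φ) (h : IsFlowFrame nabla Ω F φ τ s V)
    (h' : IsFlowFrame nabla Ω F φ τ t W) {x : M} (hx : x ∈ V) (hx' : x ∈ W) (v : L x) :
    flowTransport nabla Ω F φ s τ x v = flowTransport nabla Ω F φ t τ x v := by
  -- The transition function, t = k s. Along a flow line k' = k (θ_t − θ_s)(X_F), so k(φ^τ x) = k(x)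
  -- exp(I_t − I_s) with I the flow integrals; this cancels the change of `flowFactor`.
  let k : M → ℂ := fun y => (inner ℂ (s y) (t y) : ℂ) / inner ℂ (s y) (s y)
  have hk : ∀ y, s y ≠ 0 → k y • s y = t y := fun y hy => inner_div_inner_smul hy _
  have hode := eq_mul_exp_integral_of_hasDerivAt (h := fun r => k (φ r x)) (τ := τ)
    ((h'.continuousOn x hx').sub (h.continuousOn x hx)) (fun r hr => by
      have hsr := h.ne_zero x hx r hr
      have htr := h'.ne_zero x hx' r hr
      have hkd : MDifferentiableAt (𝓡 (2 * n)) 𝓘(ℝ, ℂ) k (φ r x) :=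
        (contMDiffAt_inner_div hL h.mem h'.mem hsr).mdifferentiableAt (by simp)
      have h1 := hφ.hasDerivAt_comp hkd
      rw [ha.connForm_of_eventuallyEq_smul h.mem h'.mem hkd ?_ htr] at h1
      · exact h1
      · filter_upwards [eventually_ne_zero hL h.mem hsr] with y hy
        exact (hk y hy).symm)
  have hI : ∫ r in (0 : ℝ)..τ, (connForm nabla t (φ r x) (hamiltonianVectorField Ω F (φ r x))
      - connForm nabla s (φ r x) (hamiltonianVectorField Ω F (φ r x)))
      = flowIntegral nabla Ω F φ t τ x - flowIntegral nabla Ω F φ s τ x :=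
    intervalIntegral.integral_sub (h'.continuousOn x hx').intervalIntegrable
      (h.continuousOn x hx).intervalIntegrable
  simp only [Pi.sub_apply] at hode
  rw [hI] at hode
  simp only [hφ.zero] at hode
  have hsx := h.ne_zero_left hφ hx
  have htx := h'.ne_zero_left hφ hx'
  obtain ⟨c, rfl⟩ := exists_smul_eq_of_ne_zero hsx v
  have hkx : k x ≠ 0 := fun h0 => htx (by rw [← hk x hsx, h0, zero_smul])
  have hss : (inner ℂ (s x) (s x) : ℂ) ≠ 0 := inner_self_ne_zero.mpr hsx
  have e1 : (inner ℂ (t x) (c • s x) : ℂ) / inner ℂ (t x) (t x) = c / k x := by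
    have hs' : c • s x = (c / k x) • t x := by
      rw [← hk x hsx, smul_smul, div_mul_cancel₀ _ hkx]
    rw [hs', inner_smul_right, mul_div_cancel_right₀ _ (inner_self_ne_zero.mpr htx)]
  unfold flowTransport flowFactor
  rw [e1, inner_smul_right, mul_div_cancel_right₀ _ hss,
    ← hk (φ τ x) (h.ne_zero x hx τ Set.right_mem_uIcc), hode, smul_smul]
  congr 1
  rw [sub_eq_add_neg (-flowIntegral nabla Ω F φ s τ x),
    sub_eq_add_neg (-flowIntegral nabla Ω F φ t τ x), Complex.exp_add, Complex.exp_add,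
    Complex.exp_neg, Complex.exp_neg, Complex.exp_sub]
  field_simp
  rw [mul_assoc, ← Complex.exp_add, neg_add_cancel, Complex.exp_zero, mul_one]

/-- By compatibility with the metric, |s|² solves y' = 2 Re θ(X_F) y along the flow. So |s| grows by
the exponential of the real part of the flow integral, which `flowFactor` removes. -/
theorem norm_flowTransport (ha : IsPrequantumConnection Ω nabla) (hL : IsSmoothHermitian (n := n) L)
    (hφ : IsHamiltonianFlow Ω F φ) (h : IsFlowFrame nabla Ω F φ τ s V) {x : M} (hx : x ∈ V)
    (v : L x) : ‖flowTransport nabla Ω F φ s τ x v‖ = ‖v‖ := by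
  let a : ℝ → ℂ := fun r => connForm nabla s (φ r x) (hamiltonianVectorField Ω F (φ r x))
  have hac : ContinuousOn a (Set.uIcc 0 τ) := h.continuousOn x hx
  have hode := eq_mul_exp_integral_of_hasDerivAt
    (h := fun r => (inner ℂ (s (φ r x)) (s (φ r x)) : ℂ)) (τ := τ)
    (g := fun r => (starRingEnd ℂ) (a r) + a r)
    ((Complex.continuous_conj.comp_continuousOn hac).add hac) (fun r hr => by
      have hd : MDifferentiableAt (𝓡 (2 * n)) 𝓘(ℝ, ℂ) (fun y => (inner ℂ (s y) (s y) : ℂ)) (φ r x) :=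
        (hL s h.mem s h.mem).mdifferentiable (by simp) _
      refine (hφ.hasDerivAt_comp hd).congr_deriv ?_
      rw [ha.hermitian s h.mem s h.mem, ← connForm_smul (h.ne_zero x hx r hr), inner_smul_left,
        inner_smul_right]
      ring)
  have hI : ∫ r in (0 : ℝ)..τ, ((starRingEnd ℂ) (a r) + a r)
      = ((2 * (flowIntegral nabla Ω F φ s τ x).re : ℝ) : ℂ) := by
    have h1 := ContinuousLinearMap.intervalIntegral_comp_comm (μ := MeasureTheory.volume)
      ((Complex.conjCLE : ℂ →L[ℝ] ℂ) + ContinuousLinearMap.id ℝ ℂ) hac.intervalIntegrable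
    rw [← Complex.add_conj, add_comm]
    exact h1
  have hsx := h.ne_zero_left hφ hx
  obtain ⟨c, rfl⟩ := exists_smul_eq_of_ne_zero hsx v
  have hnorm : ‖s (φ τ x)‖ = ‖s x‖ * Real.exp (flowIntegral nabla Ω F φ s τ x).re := by
    rw [hI, hφ.zero, inner_self_eq_norm_sq_to_K, inner_self_eq_norm_sq_to_K,
      ← Complex.ofReal_exp] at hode
    have h2 : ‖s (φ τ x)‖ ^ 2
        = ‖s x‖ ^ 2 * Real.exp (2 * (flowIntegral nabla Ω F φ s τ x).re) := by
      exact Complex.ofReal_injective (by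
        rw [Complex.ofReal_mul, Complex.ofReal_pow, Complex.ofReal_pow]; exact hode)
    rw [two_mul, Real.exp_add, ← sq, ← mul_pow] at h2
    exact (pow_left_inj₀ (norm_nonneg _) (by positivity) two_ne_zero).mp h2
  unfold flowTransport flowFactor
  rw [inner_smul_right, mul_div_cancel_right₀ _ (inner_self_ne_zero.mpr hsx), norm_smul, norm_smul,
    norm_mul, Complex.norm_exp, hnorm]
  -- F is real, so the Hamiltonian term is a pure phase.
  have hre : (-flowIntegral nabla Ω F φ s τ x - τ * (2 * (Real.pi : ℂ) * Complex.I * (F x : ℂ))).re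
      = -(flowIntegral nabla Ω F φ s τ x).re := by
    simp
  rw [hre, Real.exp_neg]
  have := Real.exp_ne_zero (flowIntegral nabla Ω F φ s τ x).re
  field_simp

theorem contMDiffAt_flowFactor (hF : ContMDiff (𝓡 (2 * n)) 𝓘(ℝ, ℝ) ∞ F)
    (h : IsFlowFrame nabla Ω F φ τ s V) {x : M} (hx : x ∈ V) :
    ContMDiffAt (𝓡 (2 * n)) 𝓘(ℝ, ℂ) ∞ (flowFactor nabla Ω F φ s τ) x := by
  have h1 : ContDiff ℝ ∞ (fun z : ℂ × ℝ =>
      Complex.exp (-z.1 - τ * (2 * (Real.pi : ℂ) * Complex.I * (z.2 : ℂ)))) := by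
    refine ContDiff.cexp ?_
    have : ContDiff ℝ ∞ (fun z : ℂ × ℝ => (z.2 : ℂ)) :=
      Complex.ofRealCLM.contDiff.comp contDiff_snd
    exact contDiff_fst.neg.sub (contDiff_const.mul (contDiff_const.mul this))
  exact h1.contMDiff.contMDiffAt.comp x ((h.contMDiffAt x hx).prodMk_space (hF x))

/-- The term 2πi τ F in the exponent is there to cancel the curvature contribution 2πi τ dF in the
derivative of the flow integral. -/
theorem mvfderiv_flowFactor (hF : ContMDiff (𝓡 (2 * n)) 𝓘(ℝ, ℝ) ∞ F)
    (h : IsFlowFrame nabla Ω F φ τ s V) {x : M} (hx : x ∈ V) (w : TangentSpace (𝓡 (2 * n)) x) :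
    mvfderiv (𝓡 (2 * n)) (flowFactor nabla Ω F φ s τ) x w = flowFactor nabla Ω F φ s τ x *
      (connForm nabla s x w
        - connForm nabla s (φ τ x) (mfderiv (𝓡 (2 * n)) (𝓡 (2 * n)) (φ τ) x w)) := by
  have hI := ((h.contMDiffAt x hx).mdifferentiableAt (by simp)).hasMFDerivAt
  have hFd := ((hF x).mdifferentiableAt (by simp)).hasMFDerivAt
  let l : ℝ →L[ℝ] ℂ := ContinuousLinearMap.toSpanSingleton ℝ
    (τ * (2 * (Real.pi : ℂ) * Complex.I))
  have hl : ∀ u : ℝ, l u = τ * (2 * (Real.pi : ℂ) * Complex.I * (u : ℂ)) := fun u => by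
    simp only [l, ContinuousLinearMap.toSpanSingleton_apply, Complex.real_smul]
    ring
  have hf := hI.neg.sub ((l.hasMFDerivAt (x := F x)).comp x hFd)
  have he := (((Complex.hasDerivAt_exp (-flowIntegral nabla Ω F φ s τ x - l (F x))).hasFDerivAt
    ).restrictScalars ℝ).hasMFDerivAt.comp x hf
  have e : flowFactor nabla Ω F φ s τ =
      Complex.exp ∘ (-flowIntegral nabla Ω F φ s τ - l ∘ F) := funext fun y => by
    simp only [flowFactor, Function.comp_apply, Pi.sub_apply, Pi.neg_apply, hl]
  have h6 := congrArg (fun l => l w) he.mfderiv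
  rw [← e] at h6
  have ex : flowFactor nabla Ω F φ s τ x
      = Complex.exp (-flowIntegral nabla Ω F φ s τ x - l (F x)) := congrFun e x
  refine Eq.trans (b := (-(mvfderiv (𝓡 (2 * n)) (flowIntegral nabla Ω F φ s τ) x w)
      - l (mvfderiv (𝓡 (2 * n)) F x w)) * flowFactor nabla Ω F φ s τ x) ?_ ?_
  · rw [ex]
    exact h6
  · rw [h.mvfderiv_eq x hx, hl]
    ring

theorem contMDiffAt_flowTransport (hφ : IsHamiltonianFlow Ω F φ)
    (hF : ContMDiff (𝓡 (2 * n)) 𝓘(ℝ, ℝ) ∞ F)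
    (h : IsFlowFrame nabla Ω F φ τ s V) {z : TotalSpace ℂ L} (hz : z.1 ∈ V) :
    ContMDiffAt ((𝓡 (2 * n)).prod 𝓘(ℝ, ℂ)) ((𝓡 (2 * n)).prod 𝓘(ℝ, ℂ)) ∞
      (fun z : TotalSpace ℂ L => (⟨φ τ z.1, flowTransport nabla Ω F φ s τ z.1 z.2⟩ :
        TotalSpace ℂ L)) z := by
  have hp : ContMDiffAt ((𝓡 (2 * n)).prod 𝓘(ℝ, ℂ)) (𝓡 (2 * n)) ∞
      (fun z : TotalSpace ℂ L => z.1) z := contMDiff_proj L z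
  refine contMDiffAt_complex_smul (b := fun z : TotalSpace ℂ L => φ τ z.1)
    (σ := fun z => s (φ τ z.1)) ?_ ?_
  · exact (h.mem (φ τ z.1)).comp z ((hφ.contMDiff τ z.1).comp z hp)
  · have hm : ContDiff ℝ ∞ (fun z : ℂ × ℂ => z.1 * z.2) := contDiff_fst.mul contDiff_snd
    exact hm.contMDiff.contMDiffAt.comp z
      (((h.contMDiffAt_flowFactor hF hz).comp z hp).prodMk_space
        (contMDiffAt_coefficient h.mem (h.ne_zero_left hφ hz)))

/-- Writing u = k s, the image is q s with q ∘ φ^τ = E k. In the Leibniz rule, dE/E = θ − (φ^τ)^*θ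
exchanges the connection form at the target for the one at the source. -/
theorem nabla_flowTransport (ha : IsPrequantumConnection Ω nabla) (hL : IsSmoothHermitian (n := n) L)
    (hφ : IsHamiltonianFlow Ω F φ) (hF : ContMDiff (𝓡 (2 * n)) 𝓘(ℝ, ℝ) ∞ F)
    (h : IsFlowFrame nabla Ω F φ τ s V) {u t : Π x : M, L x}
    (hu : u ∈ smoothSections (n := n) L) (ht : t ∈ smoothSections (n := n) L)
    (hut : ∀ x ∈ V, t (φ τ x) = flowTransport nabla Ω F φ s τ x (u x)) {x : M} (hx : x ∈ V)
    (w : TangentSpace (𝓡 (2 * n)) x) :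
    nabla t (φ τ x) (mfderiv (𝓡 (2 * n)) (𝓡 (2 * n)) (φ τ) x w)
      = flowTransport nabla Ω F φ s τ x (nabla u x w) := by
  let k : M → ℂ := fun y => (inner ℂ (s y) (u y) : ℂ) / inner ℂ (s y) (s y)
  have hsx := h.ne_zero_left hφ hx
  have hsφ := h.ne_zero x hx τ Set.right_mem_uIcc
  have hkc : ContMDiffAt (𝓡 (2 * n)) 𝓘(ℝ, ℂ) ∞ k x := contMDiffAt_inner_div hL h.mem hu hsx
  have hkd := hkc.mdifferentiableAt (by simp)
  have hu' := ha.nabla_eq_of_eventuallyEq_smul h.mem hu hkd (by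
    filter_upwards [eventually_ne_zero hL h.mem hsx] with y hy
    exact (inner_div_inner_smul hy _).symm) w
  let E := flowFactor nabla Ω F φ s τ
  have hEd : MDifferentiableAt (𝓡 (2 * n)) 𝓘(ℝ, ℂ) E x :=
    (h.contMDiffAt_flowFactor hF hx).mdifferentiableAt (by simp)
  -- The coefficient of t in the frame s near φ^τ(x), obtained by going back along the flow.
  let q : M → ℂ := fun z => (E (φ (-τ) z)) * (k (φ (-τ) z))
  have hq : MDifferentiableAt (𝓡 (2 * n)) 𝓘(ℝ, ℂ) q (φ τ x) := by
    have hback := hφ.mdifferentiableAt (-τ) (φ τ x)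
    have h1 : MDifferentiableAt (𝓡 (2 * n)) 𝓘(ℝ, ℂ) (E * k) (φ (-τ) (φ τ x)) := by
      rw [hφ.neg_apply]
      exact (hEd.hasMFDerivAt.mul hkd.hasMFDerivAt).mdifferentiableAt
    exact h1.comp _ hback
  have hqt : ∀ᶠ z in 𝓝 (φ τ x), t z = q z • s z := by
    have : φ (-τ) ⁻¹' V ∈ 𝓝 (φ τ x) :=
      (hφ.contMDiff (-τ)).continuous.continuousAt.preimage_mem_nhds (by
        rw [hφ.neg_apply]; exact h.isOpen.mem_nhds hx)
    filter_upwards [this] with z hz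
    have h1 := hut _ hz
    unfold flowTransport at h1
    rw [hφ.apply_neg] at h1
    exact h1
  have hqd : mvfderiv (𝓡 (2 * n)) q (φ τ x) (mfderiv (𝓡 (2 * n)) (𝓡 (2 * n)) (φ τ) x w)
      = E x * mvfderiv (𝓡 (2 * n)) k x w + k x * mvfderiv (𝓡 (2 * n)) E x w := by
    have h1 := (hq.hasMFDerivAt.comp x (hφ.mdifferentiableAt τ x).hasMFDerivAt).mfderiv
    have h2 : q ∘ φ τ = E * k := funext fun y => by
      simp only [q, Function.comp_apply, hφ.neg_apply, Pi.mul_apply]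
    rw [h2] at h1
    have h3 := (hEd.hasMFDerivAt.mul hkd.hasMFDerivAt).mfderiv
    exact congrArg (fun l => l w) (h1.symm.trans h3)
  rw [ha.nabla_eq_of_eventuallyEq_smul h.mem ht hq hqt, hqd, h.mvfderiv_flowFactor hF hx, hu',
    ← connForm_smul hsφ, ← connForm_smul hsx]
  unfold flowTransport
  simp only [inner_add_right, inner_smul_right]
  have hss : (inner ℂ (s x) (s x) : ℂ) ≠ 0 := inner_self_ne_zero.mpr hsx
  rw [smul_smul, ← add_smul]
  congr 1
  have hqx : q (φ τ x) = E x * k x := by simp only [q, hφ.neg_apply]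
  rw [hqx]
  simp only [E]
  field_simp
  ring

end IsFlowFrame

/-- For small times the flow lifts to the line bundle. -/
theorem IsPrequantumConnection.exists_lift_of_flowFrame (ha : IsPrequantumConnection Ω nabla)
    (hL : IsSmoothHermitian (n := n) L) (hφ : IsHamiltonianFlow Ω F φ)
    (hF : ContMDiff (𝓡 (2 * n)) 𝓘(ℝ, ℝ) ∞ F) {τ : ℝ}
    (h : ∀ x : M, ∃ s V, x ∈ V ∧ IsFlowFrame nabla Ω F φ τ s V) :
    Nonempty (PrequantumLift nabla (φ τ)) := by
  choose s V hV hfr using h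
  -- Each fibre uses its own frame; frame independence lets a single frame represent the lift on a
  -- whole neighbourhood, as smoothness and parallelism require.
  have heq : ∀ x₀, ∀ x ∈ V x₀, ∀ v : L x, flowTransport nabla Ω F φ (s x) τ x v
      = flowTransport nabla Ω F φ (s x₀) τ x v := fun x₀ x hx v =>
    (hfr x).flowTransport_eq ha hL hφ (hfr x₀) (hV x) hx v
  let T : ∀ x, L x →ₗᵢ[ℂ] L (φ τ x) := fun x =>
    { toFun := flowTransport nabla Ω F φ (s x) τ x
      map_add' := fun v w => by
        simp only [flowTransport, inner_add_right, add_div, mul_add, add_smul]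
      map_smul' := fun c v => by
        simp only [flowTransport, inner_smul_right, RingHom.id_apply, smul_smul]
        congr 1
        ring
      norm_map' := (hfr x).norm_flowTransport ha hL hφ (hV x) }
  have hsurj : ∀ x, Function.Surjective (T x) := by
    intro x v
    have hsx := (hfr x).ne_zero_left hφ (hV x)
    have hTs : T x (s x x) ≠ 0 := fun h0 => hsx (by
      rw [← norm_eq_zero, ← (T x).norm_map, h0, norm_zero])
    obtain ⟨c, rfl⟩ := exists_smul_eq_of_ne_zero hTs v
    exact ⟨c • s x x, map_smul _ _ _⟩
  refine ⟨{ map := fun x => LinearIsometryEquiv.ofSurjective (T x) (hsurj x), smooth := ?_,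
            parallel := ?_ }⟩
  · intro z
    refine ((hfr z.1).contMDiffAt_flowTransport hφ hF (hV z.1)).congr_of_eventuallyEq ?_
    have : (fun z : TotalSpace ℂ L => z.1) ⁻¹' V z.1 ∈ 𝓝 z :=
      (FiberBundle.continuous_proj ℂ L).continuousAt.preimage_mem_nhds
        ((hfr z.1).isOpen.mem_nhds (hV z.1))
    filter_upwards [this] with y hy
    exact congrArg (fun v => (⟨φ τ y.1, v⟩ : TotalSpace ℂ L)) (heq z.1 y.1 hy y.2)
  · intro u hu t ht hut x w
    exact (hfr x).nabla_flowTransport ha hL hφ hF hu ht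
      (fun y hy => (hut y).trans (heq x y hy _)) (hV x) w

end SmallTime

/-! ### Pushing, pulling and composing lifts; existence for all times -/

section Lifts

variable {n : ℕ} {M : Type u} [TopologicalSpace M]
  [ChartedSpace (EuclideanSpace ℝ (Fin (2 * n))) M] [IsManifold (𝓡 (2 * n)) ∞ M]
  {L : M → Type v} [∀ x, NormedAddCommGroup (L x)] [∀ x, InnerProductSpace ℂ (L x)]
  [TopologicalSpace (TotalSpace ℂ L)] [FiberBundle ℂ L]
  [VectorBundle ℂ ℂ L] [VectorBundle ℝ ℂ L] [ContMDiffVectorBundle ∞ ℂ L (𝓡 (2 * n))]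
  {nabla : CovariantDerivative (𝓡 (2 * n)) ℂ L} {Ω : SymplecticForm n M} {g k : M → M}

namespace PrequantumLift

/-- The image of a smooth section under a lift of a diffeomorphism. -/
theorem exists_push (Φ : PrequantumLift nabla g) (hk : ContMDiff (𝓡 (2 * n)) (𝓡 (2 * n)) ∞ k)
    (hgk : ∀ x, g (k x) = x) (hkg : ∀ x, k (g x) = x) {s : Π x : M, L x}
    (hs : s ∈ smoothSections (n := n) L) :
    ∃ t ∈ smoothSections (n := n) L, ∀ x, t (g x) = Φ.map x (s x) := by
  -- The vector over g(k y) has to be carried to the fibre over y, equal only propositionally; in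
  -- the total space this changes nothing.
  have key : ∀ {x y : M} (h : x = y) (v : L x),
      (⟨x, v⟩ : TotalSpace ℂ L) = ⟨y, h ▸ v⟩ := by
    rintro x _ rfl v
    rfl
  refine ⟨fun y => hgk y ▸ Φ.map (k y) (s (k y)), ?_, fun x => ?_⟩
  · have h := Φ.smooth.comp (ContMDiff.comp hs hk)
    refine h.congr fun y => ?_
    exact (key (hgk y) (Φ.map (k y) (s (k y)))).symm
  · have h : ∀ (y : M) (hy : y = x) (h' : g y = g x),
        (h' ▸ Φ.map y (s y) : L (g x)) = Φ.map x (s x) := by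
      rintro y rfl h'
      rfl
    exact h (k (g x)) (hkg x) (hgk (g x))

/-- The preimage of a smooth section under a lift. -/
theorem exists_pull [T2Space M] (hL : IsSmoothHermitian (n := n) L) (Φ : PrequantumLift nabla g)
    (hg : ContMDiff (𝓡 (2 * n)) (𝓡 (2 * n)) ∞ g)
    (hk : ContMDiff (𝓡 (2 * n)) (𝓡 (2 * n)) ∞ k)
    (hgk : ∀ x, g (k x) = x) (hkg : ∀ x, k (g x) = x) {t : Π x : M, L x}
    (ht : t ∈ smoothSections (n := n) L) :
    ∃ s ∈ smoothSections (n := n) L, ∀ x, t (g x) = Φ.map x (s x) := by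
  refine ⟨fun x => (Φ.map x).symm (t (g x)), fun x => ?_,
    fun x => ((Φ.map x).apply_symm_apply _).symm⟩
  -- Smoothness of the inverse lift is checked in a frame: the coefficient of the preimage in s is
  -- that of t in the pushed frame u, composed with g.
  obtain ⟨s, hs, hsx⟩ := exists_smoothSection_ne_zero (n := n) (L := L) x
  obtain ⟨u, hu, hus⟩ := Φ.exists_push hk hgk hkg hs
  have hux : u (g x) ≠ 0 := by
    rw [hus]
    simpa using hsx
  have hc : ContMDiffAt (𝓡 (2 * n)) 𝓘(ℝ, ℂ) ∞
      (fun y => (inner ℂ (u (g y)) (t (g y)) : ℂ) / inner ℂ (u (g y)) (u (g y))) x :=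
    (contMDiffAt_inner_div hL hu ht hux).comp x (hg x)
  refine (contMDiffAt_complex_smul (b := fun y : M => y) (hs x) hc).congr_of_eventuallyEq ?_
  have hev : ∀ᶠ y in 𝓝 x, u (g y) ≠ 0 :=
    hg.continuous.continuousAt.eventually (eventually_ne_zero hL hu hux)
  filter_upwards [hev] with y hy
  have h1 : (Φ.map y).symm (t (g y)) = ((inner ℂ (u (g y)) (t (g y)) : ℂ)
      / inner ℂ (u (g y)) (u (g y))) • s y := by
    rw [LinearIsometryEquiv.symm_apply_eq, map_smul, ← hus, inner_div_inner_smul hy]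
  exact congrArg (fun v => (⟨y, v⟩ : TotalSpace ℂ L)) h1

theorem nonempty_id : Nonempty (PrequantumLift nabla (id : M → M)) := by
  refine ⟨{ map := fun x => LinearIsometryEquiv.refl ℂ (L x), smooth := contMDiff_id,
            parallel := fun s _ t _ h x w => ?_ }⟩
  have : t = s := funext h
  subst this
  rw [mfderiv_id]
  rfl

/-- Parallelism is tested on pairs of sections, so an intermediate section must be produced; it is
the push of s, which is why g needs a smooth inverse. -/
theorem nonempty_comp (Φ : PrequantumLift nabla g) {g' : M → M} (Φ' : PrequantumLift nabla g')
    (hg : ContMDiff (𝓡 (2 * n)) (𝓡 (2 * n)) ∞ g) (hg' : ContMDiff (𝓡 (2 * n)) (𝓡 (2 * n)) ∞ g')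
    (hk : ContMDiff (𝓡 (2 * n)) (𝓡 (2 * n)) ∞ k)
    (hgk : ∀ x, g (k x) = x) (hkg : ∀ x, k (g x) = x) :
    Nonempty (PrequantumLift nabla (fun x => g' (g x))) := by
  refine ⟨{ map := fun x => (Φ.map x).trans (Φ'.map (g x)), smooth := Φ'.smooth.comp Φ.smooth,
            parallel := fun s hs t ht h x w => ?_ }⟩
  obtain ⟨u, hu, hus⟩ := Φ.exists_push hk hgk hkg hs
  have hut : ∀ y, t (g' y) = Φ'.map y (u y) := fun y => by
    have := h (k y)
    simp only [LinearIsometryEquiv.trans_apply] at this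
    rw [← hus, hgk] at this
    exact this
  have h1 := Φ.parallel s hs u hu hus x w
  have h2 := Φ'.parallel u hu t ht hut (g x) (mfderiv (𝓡 (2 * n)) (𝓡 (2 * n)) g x w)
  have h3 := mfderiv_comp x ((hg'.mdifferentiable (by simp)) (g x))
    ((hg.mdifferentiable (by simp)) x)
  have h4 : mfderiv (𝓡 (2 * n)) (𝓡 (2 * n)) (fun x => g' (g x)) x w
      = mfderiv (𝓡 (2 * n)) (𝓡 (2 * n)) g' (g x) (mfderiv (𝓡 (2 * n)) (𝓡 (2 * n)) g x w) :=
    congrArg (fun l => l w) h3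
  rw [h4, h2, h1]
  rfl

end PrequantumLift

theorem IsPrequantumConnection.nonempty_lift [T2Space M] [CompactSpace M]
    (ha : IsPrequantumConnection Ω nabla) (hL : IsSmoothHermitian (n := n) L) {F : M → ℝ}
    {φ : ℝ → M → M} (hφ : IsHamiltonianFlow Ω F φ) (hF : ContMDiff (𝓡 (2 * n)) 𝓘(ℝ, ℝ) ∞ F)
    (t : ℝ) : Nonempty (PrequantumLift nabla (φ t)) := by
  obtain ⟨ε, hε, h⟩ := ha.exists_flowFrame hL hφ hF
  -- N > |t|/ε makes each step t/N short enough to lift.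
  obtain ⟨N, hN⟩ := exists_nat_gt (|t| / ε)
  have hN0 : (0 : ℝ) < N := lt_of_le_of_lt (by positivity) hN
  have hτ : |t / N| < ε := by
    rw [abs_div, abs_of_pos hN0, div_lt_iff₀ hN0]
    rwa [div_lt_iff₀ hε, mul_comm] at hN
  obtain ⟨Φ⟩ := ha.exists_lift_of_flowFrame hL hφ hF (h (t / N) hτ)
  have hind : ∀ m : ℕ, Nonempty (PrequantumLift nabla (φ (m * (t / N)))) := by
    intro m
    induction m with
    | zero =>
      have : φ ((0 : ℕ) * (t / N)) = id := funext fun x => by simp [hφ.zero]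
      rw [this]
      exact PrequantumLift.nonempty_id
    | succ m ih =>
      obtain ⟨Φ'⟩ := ih
      have : φ ((m + 1 : ℕ) * (t / N)) = fun x => φ (t / N) (φ (m * (t / N)) x) :=
        funext fun x => by
          rw [← hφ.add]
          congr 1
          push_cast
          ring
      rw [this]
      exact Φ'.nonempty_comp Φ (hφ.contMDiff _) (hφ.contMDiff _) (hφ.contMDiff (-(m * (t / N))))
        (hφ.apply_neg _) (hφ.neg_apply _)
  have := hind N
  rwa [mul_div_cancel₀ _ hN0.ne'] at this

end Lifts

/-! ### Vanishing derivative and local constancy -/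

section LocallyConstant

theorem eventually_eq_of_mvfderiv_eq_zero {N : Type*} {d : ℕ} [TopologicalSpace N]
    [ChartedSpace (EuclideanSpace ℝ (Fin d)) N] [IsManifold (𝓡 d) 1 N] {F : Type*}
    [NormedAddCommGroup F] [NormedSpace ℝ F] {f : N → F} {x : N}
    (hf : ∀ᶠ y in 𝓝 x, MDifferentiableAt (𝓡 d) 𝓘(ℝ, F) f y)
    (h0 : ∀ᶠ y in 𝓝 x, ∀ w : TangentSpace (𝓡 d) y, mvfderiv (𝓡 d) f y w = 0) :
    ∀ᶠ y in 𝓝 x, f y = f x := by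
  set e := extChartAt (𝓡 d) x with he
  have hxs : x ∈ e.source := mem_extChartAt_source x
  have htgt : e.target ∈ 𝓝 (e x) := extChartAt_target_mem_nhds x
  have hcont : Filter.Tendsto e.symm (𝓝 (e x)) (𝓝 x) := by
    have := continuousAt_extChartAt_symm (I := 𝓡 d) x
    rwa [ContinuousAt, ← he, e.left_inv hxs] at this
  obtain ⟨r, hr, hball⟩ := Metric.eventually_nhds_iff_ball.mp
    ((hcont.eventually (hf.and h0)).and htgt)
  have hder : ∀ z ∈ Metric.ball (e x) r, HasFDerivAt (f ∘ e.symm) (0 : _ →L[ℝ] F) z := by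
    intro z hz
    obtain ⟨⟨h1, h2⟩, h3⟩ := hball z hz
    have hs : MDifferentiableAt 𝓘(ℝ, EuclideanSpace ℝ (Fin d)) (𝓡 d) e.symm z :=
      ((contMDiffOn_extChartAt_symm (n := 1) x).contMDiffAt
        ((isOpen_extChartAt_target x).mem_nhds h3)).mdifferentiableAt (by simp)
    have h := h1.hasMFDerivAt.comp z hs.hasMFDerivAt
    rw [hasMFDerivAt_iff_hasFDerivAt] at h
    have h4 : (0 : EuclideanSpace ℝ (Fin d) →L[ℝ] F) = (mfderiv (𝓡 d) 𝓘(ℝ, F) f (e.symm z)).comp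
        (mfderiv 𝓘(ℝ, EuclideanSpace ℝ (Fin d)) (𝓡 d) e.symm z) :=
      ContinuousLinearMap.ext fun w => (h2 _).symm
    rw [h4]
    exact h
  have hconst : ∀ z ∈ Metric.ball (e x) r, (f ∘ e.symm) z = (f ∘ e.symm) (e x) := by
    intro z hz
    exact (convex_ball (e x) r).is_const_of_fderivWithin_eq_zero (𝕜 := ℝ)
      (fun y hy => (hder y hy).differentiableAt.differentiableWithinAt)
      (fun y hy => by
        rw [fderivWithin_of_isOpen Metric.isOpen_ball hy, (hder y hy).fderiv])
      hz (Metric.mem_ball_self hr)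
  have hec : Filter.Tendsto e (𝓝 x) (𝓝 (e x)) := continuousAt_extChartAt (I := 𝓡 d) x
  filter_upwards [extChartAt_source_mem_nhds (I := 𝓡 d) x,
    hec.eventually (Metric.ball_mem_nhds _ hr)] with y hy1 hy2
  have := hconst _ hy2
  simpa only [Function.comp, e.left_inv hy1, e.left_inv hxs] using this

theorem IsPreconnected.eq_of_eventually_eq {X Y : Type*} [TopologicalSpace X] {T : Set X}
    (hT : IsPreconnected T) {f : X → Y} (h : ∀ x ∈ T, ∀ᶠ y in 𝓝 x, f y = f x) {x y : X}
    (hx : x ∈ T) (hy : y ∈ T) : f x = f y := by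
  have hl : IsLocallyConstant (fun z : T => f z) :=
    (IsLocallyConstant.iff_eventually_eq _).mpr fun z =>
      (continuous_subtype_val.continuousAt (x := z)).eventually (h z z.2)
  have := isPreconnected_iff_preconnectedSpace.mp hT
  exact hl.apply_eq_of_preconnectedSpace ⟨x, hx⟩ ⟨y, hy⟩

end LocallyConstant

/-! ### Sections with equal connection forms; uniqueness of lifts -/

section Uniqueness

variable {n : ℕ} {M : Type u} [TopologicalSpace M]
  [ChartedSpace (EuclideanSpace ℝ (Fin (2 * n))) M] [IsManifold (𝓡 (2 * n)) ∞ M]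
  {L : M → Type v} [∀ x, NormedAddCommGroup (L x)] [∀ x, InnerProductSpace ℂ (L x)]
  [TopologicalSpace (TotalSpace ℂ L)] [FiberBundle ℂ L]
  [VectorBundle ℂ ℂ L] [VectorBundle ℝ ℂ L] [ContMDiffVectorBundle ∞ ℂ L (𝓡 (2 * n))]
  {nabla : CovariantDerivative (𝓡 (2 * n)) ℂ L} {Ω : SymplecticForm n M} {g k : M → M}

theorem mfderiv_apply_of_inverse {N N' : Type*} {E H : Type*} [NormedAddCommGroup E]
    [NormedSpace ℝ E] [TopologicalSpace H] {I : ModelWithCorners ℝ E H} [TopologicalSpace N]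
    [ChartedSpace H N] [TopologicalSpace N'] [ChartedSpace H N'] {g : N → N'} {k : N' → N}
    (hk : MDifferentiable I I k) (hg : MDifferentiable I I g) (hkg : ∀ x, k (g x) = x) (x : N)
    (w : TangentSpace I x) :
    mfderiv I I k (g x) (mfderiv I I g x w) = w := by
  have h := (hk (g x)).hasMFDerivAt.comp x (hg x).hasMFDerivAt
  have h2 : HasMFDerivAt I I (k ∘ g) x (ContinuousLinearMap.id ℝ (TangentSpace I x)) := by
    have : k ∘ g = id := funext hkg
    rw [this]
    exact hasMFDerivAt_id x
  exact congrArg (fun l => l w) (hasMFDerivAt_unique h h2)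

theorem exists_mfderiv_eq {N N' : Type*} {E H : Type*} [NormedAddCommGroup E]
    [NormedSpace ℝ E] [TopologicalSpace H] {I : ModelWithCorners ℝ E H} [TopologicalSpace N]
    [ChartedSpace H N] [TopologicalSpace N'] [ChartedSpace H N'] {g : N → N'} {k : N' → N}
    (hk : MDifferentiable I I k) (hg : MDifferentiable I I g) (hkg : ∀ x, k (g x) = x)
    (hgk : ∀ x, g (k x) = x) (x : N) (w : TangentSpace I (g x)) :
    ∃ w', mfderiv I I g x w' = w := by
  have h := mfderiv_apply_of_inverse hg hk hgk (g x) w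
  revert h
  generalize mfderiv I I k (g x) w = w'
  intro h
  -- The preimage dk(w) is based at k(g x), which equals x only propositionally.
  have key : ∀ (y : N) (hy : y = x) (w' : E),
      (mfderiv I I g y : E →L[ℝ] E) w' = (mfderiv I I g x : E →L[ℝ] E) w' := by
    rintro y rfl w'
    rfl
  exact ⟨w', (key _ (hkg x) w').symm.trans h⟩

/-- Two sections with the same connection form are locally proportional, with a constant
coefficient. -/
theorem IsPrequantumConnection.eventually_inner_div_eq (ha : IsPrequantumConnection Ω nabla)
    (hL : IsSmoothHermitian (n := n) L) {s t : Π x : M, L x}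
    (hs : s ∈ smoothSections (n := n) L) (ht : t ∈ smoothSections (n := n) L) {x : M}
    (hx : s x ≠ 0) (h : ∀ᶠ y in 𝓝 x, ∀ w : TangentSpace (𝓡 (2 * n)) y,
      nabla t y w = connForm nabla s y w • t y) :
    ∀ᶠ y in 𝓝 x, (inner ℂ (s y) (t y) : ℂ) / inner ℂ (s y) (s y)
      = inner ℂ (s x) (t x) / inner ℂ (s x) (s x) := by
  have : IsManifold (𝓡 (2 * n)) 1 M := IsManifold.of_le (n := ∞) (by simp)
  have hev := eventually_ne_zero hL hs hx
  have hd : ∀ᶠ y in 𝓝 x, MDifferentiableAt (𝓡 (2 * n)) 𝓘(ℝ, ℂ)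
      (fun y => (inner ℂ (s y) (t y) : ℂ) / inner ℂ (s y) (s y)) y := by
    filter_upwards [hev] with y hy
      using (contMDiffAt_inner_div hL hs ht hy).mdifferentiableAt (by simp)
  refine eventually_eq_of_mvfderiv_eq_zero hd ?_
  filter_upwards [hev, hd, hev.eventually_nhds, h] with y hy hdy hevy hny w
  have h1 := ha.nabla_eq_of_eventuallyEq_smul hs ht hdy
    (by filter_upwards [hevy] with z hz using (inner_div_inner_smul hz (t z)).symm) w
  rw [hny w, ← connForm_smul hy w, smul_smul, mul_comm _ (connForm nabla s y w), mul_smul, inner_div_inner_smul hy (t y)] at h1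
  -- For t = h s with ∇t = θ t and ∇s = θ s, the Leibniz rule leaves dh · s = 0.
  have h2 := right_eq_add.mp h1
  exact (smul_eq_zero.mp h2).resolve_right hy

/-- The coefficient is locally constant on the open set `U`, hence constant on any connected `T`
inside it. `T` need not be open, so the result applies to a Lagrangian as well as to M∖D. -/
theorem IsPrequantumConnection.exists_eq_smul_on (ha : IsPrequantumConnection Ω nabla)
    (hL : IsSmoothHermitian (n := n) L) {s t : Π x : M, L x}
    (hs : s ∈ smoothSections (n := n) L) (ht : t ∈ smoothSections (n := n) L) {U T : Set M}
    (hU : IsOpen U) (h0 : ∀ x ∈ U, s x ≠ 0)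
    (h : ∀ x ∈ U, ∀ w : TangentSpace (𝓡 (2 * n)) x, nabla t x w = connForm nabla s x w • t x)
    (hT : IsConnected T) (hTU : T ⊆ U) : ∃ c : ℂ, ∀ x ∈ T, t x = c • s x := by
  obtain ⟨x₀, hx₀⟩ := hT.nonempty
  refine ⟨inner ℂ (s x₀) (t x₀) / inner ℂ (s x₀) (s x₀), fun x hx => ?_⟩
  rw [← IsPreconnected.eq_of_eventually_eq hT.isPreconnected
    (f := fun y => (inner ℂ (s y) (t y) : ℂ) / inner ℂ (s y) (s y)) (fun y hy =>
      ha.eventually_inner_div_eq hL hs ht (h0 y (hTU hy))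
        (Filter.mem_of_superset (hU.mem_nhds (hTU hy)) h)) hx hx₀]
  exact (inner_div_inner_smul (h0 x (hTU hx)) (t x)).symm

theorem PrequantumLift.nabla_apply (Φ : PrequantumLift nabla g) {s u : Π x : M, L x}
    (hs : s ∈ smoothSections (n := n) L) (hu : u ∈ smoothSections (n := n) L)
    (hus : ∀ x, u (g x) = Φ.map x (s x)) {x : M} (hx : s x ≠ 0) (w : TangentSpace (𝓡 (2 * n)) x) :
    nabla u (g x) (mfderiv (𝓡 (2 * n)) (𝓡 (2 * n)) g x w) = connForm nabla s x w • u (g x) := by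
  rw [Φ.parallel s hs u hu hus x w, ← connForm_smul hx, map_smul, hus]

theorem PrequantumLift.connForm_apply (Φ : PrequantumLift nabla g) {s u : Π x : M, L x}
    (hs : s ∈ smoothSections (n := n) L) (hu : u ∈ smoothSections (n := n) L)
    (hus : ∀ x, u (g x) = Φ.map x (s x)) {x : M} (hx : s x ≠ 0) (w : TangentSpace (𝓡 (2 * n)) x) :
    connForm nabla u (g x) (mfderiv (𝓡 (2 * n)) (𝓡 (2 * n)) g x w) = connForm nabla s x w :=
  connForm_eq_of_eq_smul (by rw [hus]; simpa using hx) (Φ.nabla_apply hs hu hus hx w)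

/-- Lifts of a diffeomorphism are unique up to a constant. -/
theorem PrequantumLift.exists_map_eq_smul [T2Space M] [ConnectedSpace M]
    (ha : IsPrequantumConnection Ω nabla) (hL : IsSmoothHermitian (n := n) L)
    (hg : ContMDiff (𝓡 (2 * n)) (𝓡 (2 * n)) ∞ g) (hk : ContMDiff (𝓡 (2 * n)) (𝓡 (2 * n)) ∞ k)
    (hgk : ∀ x, g (k x) = x) (hkg : ∀ x, k (g x) = x) (Φ Ψ : PrequantumLift nabla g) :
    ∃ c : ℂ, ∀ x (v : L x), Ψ.map x v = c • Φ.map x v := by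
  have hex : ∀ x, ∃ c : ℂ, ∀ v : L x, Ψ.map x v = c • Φ.map x v := by
    intro x
    obtain ⟨s, -, hsx⟩ := exists_smoothSection_ne_zero (n := n) (L := L) x
    have hne : Φ.map x (s x) ≠ 0 := by simpa using hsx
    obtain ⟨c, hc⟩ := exists_smul_eq_of_ne_zero hne (Ψ.map x (s x))
    refine ⟨c, fun v => ?_⟩
    obtain ⟨b, rfl⟩ := exists_smul_eq_of_ne_zero hsx v
    rw [map_smul, map_smul, hc, smul_comm]
  choose l hl using hex
  -- The two pushes of one section s have the same connection form, that of s, so their ratio, which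
  -- is the ratio of the lifts, is locally constant.
  have hloc : ∀ x ∈ (Set.univ : Set M), ∀ᶠ y in 𝓝 x, l y = l x := by
    intro x _
    obtain ⟨s, hs, hsx⟩ := exists_smoothSection_ne_zero (n := n) (L := L) x
    obtain ⟨u, hu, hus⟩ := Φ.exists_push hk hgk hkg hs
    obtain ⟨u', hu', hus'⟩ := Ψ.exists_push hk hgk hkg hs
    have hne : ∀ y, s y ≠ 0 → u (g y) ≠ 0 := fun y hy => by rw [hus]; simpa using hy
    have hcoef : ∀ y, s y ≠ 0 →
        (inner ℂ (u (g y)) (u' (g y)) : ℂ) / inner ℂ (u (g y)) (u (g y)) = l y := by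
      intro y hy
      rw [hus', hl, ← hus, inner_smul_right,
        mul_div_cancel_right₀ _ (inner_self_ne_zero.mpr (hne y hy))]
    have hev : ∀ᶠ z in 𝓝 (g x), ∀ w : TangentSpace (𝓡 (2 * n)) z,
        nabla u' z w = connForm nabla u z w • u' z := by
      have h1 : ∀ᶠ z in 𝓝 (g x), s (k z) ≠ 0 := by
        have h2 : ContinuousAt k (g x) := hk.continuous.continuousAt
        rw [ContinuousAt, hkg] at h2
        exact h2.eventually (eventually_ne_zero hL hs hsx)
      filter_upwards [h1] with z hz
      obtain ⟨y, rfl⟩ : ∃ y, g y = z := ⟨k z, hgk z⟩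
      rw [hkg] at hz
      intro w
      obtain ⟨w, rfl⟩ := exists_mfderiv_eq (hk.mdifferentiable (by simp))
        (hg.mdifferentiable (by simp)) hkg hgk y w
      rw [Φ.connForm_apply hs hu hus hz, Ψ.nabla_apply hs hu' hus' hz]
    have h2 := hg.continuous.continuousAt.eventually
      (ha.eventually_inner_div_eq hL hu hu' (hne x hsx) hev)
    filter_upwards [h2, eventually_ne_zero hL hs hsx] with y hy hsy
    rwa [hcoef y hsy, hcoef x hsx] at hy
  obtain ⟨x₀⟩ : Nonempty M := inferInstance
  exact ⟨l x₀, fun x v => by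
    rw [hl, isPreconnected_univ.eq_of_eventually_eq hloc (Set.mem_univ x) (Set.mem_univ x₀)]⟩

end Uniqueness

/-! ### Lifts cover symplectomorphisms -/

section Symplectic

variable {n : ℕ} {M : Type u} [TopologicalSpace M]
  [ChartedSpace (EuclideanSpace ℝ (Fin (2 * n))) M] [IsManifold (𝓡 (2 * n)) ∞ M]
  {L : M → Type v} [∀ x, NormedAddCommGroup (L x)] [∀ x, InnerProductSpace ℂ (L x)]
  [TopologicalSpace (TotalSpace ℂ L)] [FiberBundle ℂ L]
  [VectorBundle ℂ ℂ L] [VectorBundle ℝ ℂ L] [ContMDiffVectorBundle ∞ ℂ L (𝓡 (2 * n))]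
  {nabla : CovariantDerivative (𝓡 (2 * n)) ℂ L} {Ω : SymplecticForm n M} {g k : M → M}

theorem exists_isSmoothVectorField [T2Space M] (x : M) (v : TangentSpace (𝓡 (2 * n)) x) :
    ∃ X : Π y : M, TangentSpace (𝓡 (2 * n)) y, IsSmoothVectorField X ∧ X x = v := by
  obtain ⟨ψ, hψ1, hψ⟩ := exists_global_section_eventuallyEq (m := 2 * n)
    (fun x : M => TangentSpace (𝓡 (2 * n)) x) (extChartAt_source_mem_nhds (I := 𝓡 (2 * n)) x)
    (fun v => coordField x v) (fun v y hy => contMDiffAt_coordField x v hy)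
  refine ⟨_, hψ (mvfderiv (𝓡 (2 * n)) (extChartAt (𝓡 (2 * n)) x) x v), ?_⟩
  have h1 : ψ x = 1 := hψ1.eq_of_nhds
  simp only [h1, one_smul]
  exact coordField_mvfderiv x (mem_extChartAt_source x) v

theorem isInvertible_mfderiv_of_inverse (hg : ContMDiff (𝓡 (2 * n)) (𝓡 (2 * n)) ∞ g)
    (hk : ContMDiff (𝓡 (2 * n)) (𝓡 (2 * n)) ∞ k) (hgk : ∀ x, g (k x) = x)
    (hkg : ∀ x, k (g x) = x) (x : M) :
    (mfderiv (𝓡 (2 * n)) (𝓡 (2 * n)) g x).IsInvertible := by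
  let G : M ≃ₘ^∞⟮𝓡 (2 * n), 𝓡 (2 * n)⟯ M := ⟨⟨g, k, hkg, hgk⟩, hg, hk⟩
  exact ⟨G.mfderivToContinuousLinearEquiv (by simp) x, rfl⟩

/-- A diffeomorphism with a lift to the prequantum bundle is a symplectomorphism. -/
theorem PrequantumLift.form_mfderiv [T2Space M] (Φ : PrequantumLift nabla g)
    (ha : IsPrequantumConnection Ω nabla)
    (hg : ContMDiff (𝓡 (2 * n)) (𝓡 (2 * n)) ∞ g) (hk : ContMDiff (𝓡 (2 * n)) (𝓡 (2 * n)) ∞ k)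
    (hgk : ∀ x, g (k x) = x) (hkg : ∀ x, k (g x) = x) (x : M)
    (v w : TangentSpace (𝓡 (2 * n)) x) :
    Ω.form (g x) (mfderiv (𝓡 (2 * n)) (𝓡 (2 * n)) g x v)
      (mfderiv (𝓡 (2 * n)) (𝓡 (2 * n)) g x w) = Ω.form x v w := by
  have : IsManifold (𝓡 (2 * n)) (minSmoothness ℝ 2) M := by
    rw [minSmoothness_of_isRCLikeNormedField]
    exact IsManifold.of_le (n := ∞) ENat.LEInfty.out
  have : IsManifold (𝓡 (2 * n)) 1 M := IsManifold.of_le (n := ∞) (by simp)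
  have hinv := isInvertible_mfderiv_of_inverse hg hk hgk hkg
  obtain ⟨X', hX', hXv⟩ := exists_isSmoothVectorField (g x) (mfderiv (𝓡 (2 * n)) (𝓡 (2 * n)) g x v)
  obtain ⟨Y', hY', hYw⟩ := exists_isSmoothVectorField (g x) (mfderiv (𝓡 (2 * n)) (𝓡 (2 * n)) g x w)
  have hpb : ∀ V : Π y : M, TangentSpace (𝓡 (2 * n)) y, IsSmoothVectorField V →
      IsSmoothVectorField (VectorField.mpullback (𝓡 (2 * n)) (𝓡 (2 * n)) g V) := fun V hV y =>
    ContMDiffAt.mpullback_vectorField_preimage (n := ∞) (hV (g y)) (hg y) (hinv y) (by simp)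
  have happ : ∀ (V : Π y : M, TangentSpace (𝓡 (2 * n)) y) (y : M),
      mfderiv (𝓡 (2 * n)) (𝓡 (2 * n)) g y
        (VectorField.mpullback (𝓡 (2 * n)) (𝓡 (2 * n)) g V y) = V (g y) := fun V y =>
    congrArg (fun f => f (V (g y))) (hinv y).self_comp_inverse
  have hinj : ∀ u u' : TangentSpace (𝓡 (2 * n)) x, mfderiv (𝓡 (2 * n)) (𝓡 (2 * n)) g x u
      = mfderiv (𝓡 (2 * n)) (𝓡 (2 * n)) g x u' → u = u' := fun u u' h => by
    rw [← mfderiv_apply_of_inverse (hk.mdifferentiable (by simp)) (hg.mdifferentiable (by simp))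
      hkg x u, h, mfderiv_apply_of_inverse (hk.mdifferentiable (by simp))
      (hg.mdifferentiable (by simp)) hkg x u']
  set X := VectorField.mpullback (𝓡 (2 * n)) (𝓡 (2 * n)) g X' with hXdef
  set Y := VectorField.mpullback (𝓡 (2 * n)) (𝓡 (2 * n)) g Y' with hYdef
  have hXx : X x = v := hinj _ _ ((happ X' x).trans hXv)
  have hYx : Y x = w := hinj _ _ ((happ Y' x).trans hYw)
  obtain ⟨s, hs, hsx⟩ := exists_smoothSection_ne_zero (n := n) (L := L) x
  obtain ⟨u, hu, hus⟩ := Φ.exists_push hk hgk hkg hs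
  have h1 : ∀ (V : Π y : M, TangentSpace (𝓡 (2 * n)) y) (y : M), nabla u (g y) (V (g y))
      = Φ.map y (nabla s y (VectorField.mpullback (𝓡 (2 * n)) (𝓡 (2 * n)) g V y)) := by
    intro V y
    rw [← Φ.parallel s hs u hu hus, happ]
  have h2 : ∀ V W : Π y : M, TangentSpace (𝓡 (2 * n)) y, IsSmoothVectorField V →
      IsSmoothVectorField W → ∀ y, nabla (fun z => nabla u z (V z)) (g y) (W (g y))
      = Φ.map y (nabla (fun z => nabla s z (VectorField.mpullback (𝓡 (2 * n)) (𝓡 (2 * n)) g V z)) y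
        (VectorField.mpullback (𝓡 (2 * n)) (𝓡 (2 * n)) g W y)) := by
    intro V W hV hW y
    rw [← Φ.parallel _ (ha.nabla_mem hs (hpb V hV)) _ (ha.nabla_mem hu hV) (h1 V), happ]
  have hbr : VectorField.mpullback (𝓡 (2 * n)) (𝓡 (2 * n)) g
      (VectorField.mlieBracket (𝓡 (2 * n)) X' Y') x = VectorField.mlieBracket (𝓡 (2 * n)) X Y x :=
    VectorField.mpullback_mlieBracket (n := ∞)
      ((hX' (g x)).mdifferentiableAt (by simp)) ((hY' (g x)).mdifferentiableAt (by simp)) (hg x)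
      (by rw [minSmoothness_of_isRCLikeNormedField]; exact ENat.LEInfty.out)
  -- The curvature identity is written for the pushed section at g x and for s at x, with g-related
  -- fields. The lift matches the left sides, so the values of Ω agree.
  have hc := ha.curvature X' Y' hX' hY' u hu (g x)
  have hc' := ha.curvature X Y (hpb X' hX') (hpb Y' hY') s hs x
  rw [h2 Y' X' hY' hX', h2 X' Y' hX' hY', h1 (VectorField.mlieBracket (𝓡 (2 * n)) X' Y'), hbr,
    ← map_sub, ← map_sub, ← hXdef, ← hYdef, hc', map_smul, hus, hXx, hYx, hXv, hYw] at hc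
  have hne : Φ.map x (s x) ≠ 0 := by simpa using hsx
  have h3 := smul_left_injective ℂ hne hc
  have h4 : (2 * (Real.pi : ℂ) * Complex.I) ≠ 0 := Complex.two_pi_I_ne_zero
  exact_mod_cast (mul_left_cancel₀ h4 h3).symm

end Symplectic

/-! ### Smooth embeddings under diffeomorphisms and reparametrization -/

section Embeddings

variable {E E' H H' : Type*} [NormedAddCommGroup E] [NormedSpace ℝ E] [NormedAddCommGroup E']
  [NormedSpace ℝ E'] [TopologicalSpace H] [TopologicalSpace H'] {I : ModelWithCorners ℝ E H}
  {J : ModelWithCorners ℝ E' H'} {N M : Type*} [TopologicalSpace N] [ChartedSpace H N]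
  [TopologicalSpace M] [ChartedSpace H' M]

/-- Precomposing the codomain chart with k = g⁻¹ leaves the expression of the map in charts
unchanged. -/
theorem Manifold.IsImmersionAtOfComplement.comp_of_inverse [IsManifold J ∞ M] {F : Type*}
    [NormedAddCommGroup F] [NormedSpace ℝ F] {i : N → M} {x : N}
    (hi : IsImmersionAtOfComplement F I J ∞ i x) {g k : M → M} (hg : ContMDiff J J ∞ g)
    (hk : ContMDiff J J ∞ k) (hgk : ∀ x, g (k x) = x) (hkg : ∀ x, k (g x) = x) :
    IsImmersionAtOfComplement F I J ∞ (g ∘ i) x := by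
  let K : M ≃ₜ M := ⟨⟨k, g, hgk, hkg⟩, hk.continuous, hg.continuous⟩
  refine IsImmersionAtOfComplement.mk_of_charts hi.equiv hi.domChart
    (K.transOpenPartialHomeomorph hi.codChart) hi.mem_domChart_source ?_
    hi.domChart_mem_maximalAtlas ?_ ?_ ?_
  · change k (g (i x)) ∈ hi.codChart.source
    rw [hkg]
    exact hi.mem_codChart_source
  · refine OpenPartialHomeomorph.mem_maximalAtlas_of_contMDiffOn _ ?_ ?_
    · exact (contMDiffOn_of_mem_maximalAtlas hi.codChart_mem_maximalAtlas).comp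
        hk.contMDiffOn fun y hy => hy
    · exact hg.comp_contMDiffOn
        (contMDiffOn_symm_of_mem_maximalAtlas hi.codChart_mem_maximalAtlas)
  · intro y hy
    change k (g (i y)) ∈ hi.codChart.source
    rw [hkg]
    exact hi.source_subset_preimage_source hy
  · intro z hz
    rw [← hi.writtenInCharts hz]
    change J (hi.codChart (k (g (i _)))) = J (hi.codChart (i _))
    rw [hkg]

theorem Manifold.IsSmoothEmbedding.comp_of_inverse [IsManifold J ∞ M] {i : N → M}
    (hi : IsSmoothEmbedding I J ∞ i) {g k : M → M} (hg : ContMDiff J J ∞ g)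
    (hk : ContMDiff J J ∞ k) (hgk : ∀ x, g (k x) = x) (hkg : ∀ x, k (g x) = x) :
    IsSmoothEmbedding I J ∞ (g ∘ i) := by
  let G : M ≃ₜ M := ⟨⟨g, k, hkg, hgk⟩, hg.continuous, hk.continuous⟩
  refine ⟨?_, G.isEmbedding.comp hi.isEmbedding⟩
  obtain ⟨F, _, _, h⟩ := hi.isImmersion
  exact ⟨F, _, _, fun x => (h x).comp_of_inverse hg hk hgk hkg⟩

/-- Two smooth embeddings with the same image have the same tangent spaces. -/
theorem Manifold.IsSmoothEmbedding.exists_mfderiv_eq [IsManifold I ∞ N] [IsManifold J ∞ M]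
    {i j : N → M} (hi : IsSmoothEmbedding I J ∞ i) (hj : IsSmoothEmbedding I J ∞ j)
    (h : Set.range j = Set.range i) (s : N) (w : TangentSpace I s) :
    ∃ (s' : N) (w' : TangentSpace I s') (_ : i s' = j s),
      (mfderiv I J i s' w' : E') = mfderiv I J j s w := by
  have hex : ∀ y, ∃ y', i y' = j y := fun y => by
    have : j y ∈ Set.range i := h ▸ Set.mem_range_self y
    exact this
  choose θ hθ using hex
  have hcomp : i ∘ θ = j := funext hθ
  have hc : Continuous θ := by
    rw [hi.isEmbedding.continuous_iff, hcomp]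
    exact hj.isEmbedding.continuous
  -- The change of parameters θ = i⁻¹ ∘ j is smooth because i is an immersion and i ∘ θ = j is
  -- smooth; then dj = di ∘ dθ.
  have hs : ContMDiff I I ∞ θ := by
    rw [ContMDiff.iff_comp_isImmersion hi.isImmersion, hcomp]
    exact ⟨hc, hj.contMDiff⟩
  refine ⟨θ s, mfderiv I I θ s w, hθ s, ?_⟩
  have h1 := mfderiv_comp s (hi.contMDiff.mdifferentiable (by simp) (θ s))
    (hs.mdifferentiable (by simp) s)
  rw [hcomp] at h1
  exact (congrArg (fun l : E →L[ℝ] E' => l w) h1).symm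

end Embeddings

/-! ### Homotopy invariance -/

section Homology

theorem integralHomologyMap_eq_of_homotopy (k : ℕ) {X Y : Type u} [TopologicalSpace X]
    [TopologicalSpace Y] {f f' : C(X, Y)} (h : f.Homotopy f') :
    integralHomologyMap k f = integralHomologyMap k f' := by
  unfold integralHomologyMap
  congr 1
  exact TopCat.Homotopy.congr_homologyMap_singularChainComplexFunctor
    (f := TopCat.ofHom f) (g := TopCat.ofHom f') h _ k

end Homology

/-! ### Transport of Lagrangians, parallel frames and 1-forms -/

section Transport

variable {n : ℕ} {M : Type u} [TopologicalSpace M]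
  [ChartedSpace (EuclideanSpace ℝ (Fin (2 * n))) M] [IsManifold (𝓡 (2 * n)) ∞ M]
  {L : M → Type v} [∀ x, NormedAddCommGroup (L x)] [∀ x, InnerProductSpace ℂ (L x)]
  [TopologicalSpace (TotalSpace ℂ L)] [FiberBundle ℂ L]
  [VectorBundle ℂ ℂ L] [VectorBundle ℝ ℂ L] [ContMDiffVectorBundle ∞ ℂ L (𝓡 (2 * n))]
  {nabla : CovariantDerivative (𝓡 (2 * n)) ℂ L} {Ω : SymplecticForm n M} {g k : M → M}
  {S₀ : Type u} [TopologicalSpace S₀] [ChartedSpace (EuclideanSpace ℝ (Fin n)) S₀]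
  [IsManifold (𝓡 n) ∞ S₀]

theorem mem_zeroSet_mk {α : smoothSections (n := n) L} (hα : α ≠ 0) (x : M) :
    x ∈ zeroSet (Projectivization.mk ℂ α hα) ↔ (α : Π x : M, L x) x = 0 := by
  obtain ⟨a, ha⟩ := Projectivization.exists_smul_eq_mk_rep ℂ α hα
  change ((Projectivization.mk ℂ α hα).rep : Π x : M, L x) x = 0 ↔ _
  rw [← ha]
  exact smul_eq_zero_iff_eq a

/-- ∇α/α is unchanged when α is scaled by a constant, so the chosen representative is immaterial. -/
theorem IsPrequantumConnection.rhoForm_mk (ha : IsPrequantumConnection Ω nabla)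
    {α : smoothSections (n := n) L} (hα : α ≠ 0) (x : M) (w : TangentSpace (𝓡 (2 * n)) x) :
    rhoForm nabla (Projectivization.mk ℂ α hα) x w = connForm nabla α x w := by
  obtain ⟨a, h⟩ := Projectivization.exists_smul_eq_mk_rep ℂ α hα
  have hrep : ((Projectivization.mk ℂ α hα).rep : Π x : M, L x)
      = (a : ℂ) • (α : Π x : M, L x) := by
    rw [← h]
    rfl
  have hne : (a : ℂ) ≠ 0 := a.ne_zero
  have hne' : (starRingEnd ℂ) (a : ℂ) ≠ 0 := by simp
  rw [rhoForm, connForm, hrep, ha.complexLinear _ α.2, Pi.smul_apply, inner_smul_left,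
    inner_smul_right, inner_smul_left, inner_smul_right, mul_div_mul_left _ _ hne',
    mul_div_mul_left _ _ hne]

theorem isOpen_compl_zeroSet (hL : IsSmoothHermitian (n := n) L)
    (p : ℙ ℂ (smoothSections (n := n) L)) : IsOpen (zeroSet p)ᶜ :=
  isOpen_iff_mem_nhds.mpr fun _ hx => eventually_ne_zero hL p.rep.2 hx

theorem mfderiv_comp_apply_of_smooth (hg : ContMDiff (𝓡 (2 * n)) (𝓡 (2 * n)) ∞ g) {i : S₀ → M}
    (hi : ContMDiff (𝓡 n) (𝓡 (2 * n)) ∞ i) (s : S₀) (w : TangentSpace (𝓡 n) s) :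
    mfderiv (𝓡 n) (𝓡 (2 * n)) (g ∘ i) s w
      = mfderiv (𝓡 (2 * n)) (𝓡 (2 * n)) g (i s) (mfderiv (𝓡 n) (𝓡 (2 * n)) i s w) :=
  congrArg (fun l => l w) (mfderiv_comp s (hg.mdifferentiable (by simp) (i s))
    (hi.mdifferentiable (by simp) s))

theorem IsLagrangianEmbedding.comp_lift [T2Space M] {i : C(S₀, M)}
    (hi : IsLagrangianEmbedding Ω i) (Φ : PrequantumLift nabla g)
    (ha : IsPrequantumConnection Ω nabla)
    (hg : ContMDiff (𝓡 (2 * n)) (𝓡 (2 * n)) ∞ g) (hk : ContMDiff (𝓡 (2 * n)) (𝓡 (2 * n)) ∞ k)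
    (hgk : ∀ x, g (k x) = x) (hkg : ∀ x, k (g x) = x) :
    IsLagrangianEmbedding Ω (ContinuousMap.comp ⟨g, hg.continuous⟩ i) := by
  refine ⟨hi.embedding.comp_of_inverse hg hk hgk hkg, fun s w w' => ?_⟩
  have h := mfderiv_comp_apply_of_smooth hg hi.embedding.contMDiff s
  have h' := Φ.form_mfderiv ha hg hk hgk hkg (i s) (mfderiv (𝓡 n) (𝓡 (2 * n)) i s w)
    (mfderiv (𝓡 n) (𝓡 (2 * n)) i s w')
  rw [← h w, ← h w', hi.isotropic s w w'] at h'
  exact h'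

/-- A test section near φ(S) is pulled back through the lift, and the coefficient function on S₀
stays the same; the parallel equation upstairs is the image of the one below. -/
theorem IsParallelFrameAlong.comp_lift [T2Space M] {i : C(S₀, M)} {σ : Π s : S₀, L (i s)}
    (hσ : IsParallelFrameAlong nabla i σ) (hi : ContMDiff (𝓡 n) (𝓡 (2 * n)) ∞ i)
    (hL : IsSmoothHermitian (n := n) L) (Φ : PrequantumLift nabla g)
    (hg : ContMDiff (𝓡 (2 * n)) (𝓡 (2 * n)) ∞ g) (hk : ContMDiff (𝓡 (2 * n)) (𝓡 (2 * n)) ∞ k)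
    (hgk : ∀ x, g (k x) = x) (hkg : ∀ x, k (g x) = x) :
    IsParallelFrameAlong nabla (ContinuousMap.comp ⟨g, hg.continuous⟩ i)
      (fun s => Φ.map (i s) (σ s)) where
  smooth := Φ.smooth.comp hσ.smooth
  ne_zero s := by simpa using hσ.ne_zero s
  parallel τ hτ h s hh hev w := by
    obtain ⟨τ₀, hτ₀, hττ⟩ := Φ.exists_pull hL hg hk hgk hkg hτ
    have hev' : ∀ᶠ s' in 𝓝 s, σ s' = h s' • τ₀ (i s') := by
      filter_upwards [hev] with s' hs'
      refine (Φ.map (i s')).injective (hs'.trans ?_)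
      rw [map_smul, ← hττ]
      rfl
    have h1 := congrArg (Φ.map (i s)) (hσ.parallel τ₀ hτ₀ h s hh hev' w)
    rw [map_add, map_smul, map_smul, map_zero, ← Φ.parallel τ₀ hτ₀ τ hτ hττ, ← hττ,
      ← mfderiv_comp_apply_of_smooth hg hi s w] at h1
    exact h1

/-- Off its constant phase α is f times a parallel frame, so ∇α/α restricts to df/f, a real form. -/
theorem IsParallelFrameAlong.im_connForm {i : C(S₀, M)} {σ : Π s : S₀, L (i s)}
    (hσ : IsParallelFrameAlong nabla i σ) {α : Π x : M, L x}
    (hα : α ∈ smoothSections (n := n) L) {c : ℝ} {f : S₀ → ℝ}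
    (hf : ContMDiff (𝓡 n) 𝓘(ℝ, ℝ) ∞ f) (hpos : ∀ s, 0 < f s)
    (h : ∀ s, α (i s) = (Complex.exp (Complex.I * c) * (f s : ℂ)) • σ s) (s : S₀)
    (w : TangentSpace (𝓡 n) s) :
    (connForm nabla α (i s) (mfderiv (𝓡 n) (𝓡 (2 * n)) i s w)).im = 0 := by
  set e := Complex.exp (Complex.I * c) with he
  have he0 : e ≠ 0 := Complex.exp_ne_zero _
  have hf0 : ∀ s, (f s : ℂ) ≠ 0 := fun s => by exact_mod_cast (hpos s).ne'
  have hne : α (i s) ≠ 0 := by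
    rw [h]
    exact smul_ne_zero (mul_ne_zero he0 (hf0 s)) (hσ.ne_zero s)
  -- The parallel equation is stated for σ as a multiple of a global section; here σ = e⁻¹ f⁻¹ · α ∘
  -- i.
  have hinv : ContDiffAt ℝ ∞ (fun r : ℝ => e⁻¹ * ((r⁻¹ : ℝ) : ℂ)) (f s) :=
    contDiffAt_const.mul ((Complex.ofRealCLM.contDiff.contDiffAt).comp _
      (contDiffAt_inv ℝ (hpos s).ne'))
  have hd : HasFDerivAt (fun r : ℝ => e⁻¹ * ((r⁻¹ : ℝ) : ℂ))
      (ContinuousLinearMap.toSpanSingleton ℝ (e⁻¹ * ((-(f s ^ 2)⁻¹ : ℝ) : ℂ))) (f s) :=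
    (((hasDerivAt_inv (hpos s).ne').ofReal_comp).const_mul e⁻¹).hasFDerivAt
  have hsm : ContMDiffAt (𝓡 n) 𝓘(ℝ, ℂ) ∞ (fun s => e⁻¹ * (((f s)⁻¹ : ℝ) : ℂ)) s :=
    hinv.contMDiffAt.comp s (hf s)
  have h1 := hσ.parallel α hα (fun s => e⁻¹ * (((f s)⁻¹ : ℝ) : ℂ)) s hsm
    (Filter.Eventually.of_forall fun s' => by
      rw [h, smul_smul]
      have : e⁻¹ * (((f s')⁻¹ : ℝ) : ℂ) * (e * (f s' : ℂ)) = 1 := by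
        have := hf0 s'
        push_cast
        field_simp
      rw [this, one_smul]) w
  have h2 := mvfderiv_comp_differentiable (I := 𝓡 n) (hd.differentiableAt)
    ((hf s).mdifferentiableAt (by simp)) w
  rw [h2, hd.fderiv, ← connForm_smul hne, smul_smul, ← add_smul] at h1
  have h3 := (smul_eq_zero.mp h1).resolve_right hne
  set r : ℝ := mvfderiv (𝓡 n) f s w with hr
  have h4 : connForm nabla α (i s) (mfderiv (𝓡 n) (𝓡 (2 * n)) i s w)
      = ((r * (f s)⁻¹ : ℝ) : ℂ) := by
    rw [ContinuousLinearMap.toSpanSingleton_apply, Complex.real_smul] at h3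
    have := hf0 s
    push_cast at h3 ⊢
    field_simp at h3 ⊢
    linear_combination h3
  rw [h4, Complex.ofReal_im]

/-- All parametrizations of one submanifold have the same tangent spaces, so a single one suffices.
-/
theorem imVanishesOn_of_embedding {ρ : ∀ x : M, TangentSpace (𝓡 (2 * n)) x → ℂ} {i : C(S₀, M)}
    (hi : IsSmoothEmbedding (𝓡 n) (𝓡 (2 * n)) ∞ i)
    (h : ∀ (s : S₀) (w : TangentSpace (𝓡 n) s),
      (ρ (i s) (mfderiv (𝓡 n) (𝓡 (2 * n)) i s w)).im = 0) :
    ImVanishesOn S₀ ρ (Set.range i) := by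
  intro j hj hr s w
  obtain ⟨s', w', h1, h2⟩ := hi.exists_mfderiv_eq hj hr s w
  have key : ∀ (x y : M) (_ : x = y) (v : EuclideanSpace ℝ (Fin (2 * n))), ρ x v = ρ y v := by
    rintro x _ rfl v
    rfl
  have h3 : ρ (j s) (mfderiv (𝓡 n) (𝓡 (2 * n)) j s w)
      = ρ (i s') (mfderiv (𝓡 n) (𝓡 (2 * n)) i s' w') :=
    (congrArg (ρ (j s)) h2.symm).trans (key _ _ h1 _).symm
  rw [h3, h s' w']

theorem IsHamiltonianFlow.integralHomologyMap_comp {F : M → ℝ} {φ : ℝ → M → M}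
    (hφ : IsHamiltonianFlow Ω F φ) (t : ℝ) (i : C(S₀, M)) :
    integralHomologyMap n (ContinuousMap.comp ⟨φ t, (hφ.contMDiff t).continuous⟩ i)
      = integralHomologyMap n i := by
  refine (integralHomologyMap_eq_of_homotopy n
    -- The flow from time 0 to time t, rescaled to the unit interval.
    { toFun := fun z => φ (z.1 * t) (i z.2)
      continuous_toFun := ?_
      map_zero_left := fun s => ?_
      map_one_left := fun s => ?_ }).symm
  · exact hφ.smooth.continuous.comp (by fun_prop : Continuous fun z : unitInterval × S₀ =>
      (((z.1 : ℝ) * t, i z.2) : ℝ × M))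
  · simp [hφ.zero]
  · simp

end Transport

/-! ### The induced action on sections and cycles -/

section FlowAction

variable {n : ℕ} {M : Type u} [TopologicalSpace M]
  [ChartedSpace (EuclideanSpace ℝ (Fin (2 * n))) M] [IsManifold (𝓡 (2 * n)) ∞ M]
  {L : M → Type v} [∀ x, NormedAddCommGroup (L x)] [∀ x, InnerProductSpace ℂ (L x)]
  [TopologicalSpace (TotalSpace ℂ L)] [FiberBundle ℂ L]
  [VectorBundle ℂ ℂ L] [VectorBundle ℝ ℂ L] [ContMDiffVectorBundle ∞ ℂ L (𝓡 (2 * n))]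
  {nabla : CovariantDerivative (𝓡 (2 * n)) ℂ L} {Ω : SymplecticForm n M}
  {S₀ : Type u} [TopologicalSpace S₀] [ChartedSpace (EuclideanSpace ℝ (Fin n)) S₀]
  [IsManifold (𝓡 n) ∞ S₀] {F : M → ℝ} {φ : ℝ → M → M}

/-- The image of a point of the projective space of sections under a lift, and its uniqueness. -/
theorem PrequantumLift.isTransported_iff [T2Space M] [ConnectedSpace M] {g k : M → M}
    (Φ : PrequantumLift nabla g) (ha : IsPrequantumConnection Ω nabla)
    (hL : IsSmoothHermitian (n := n) L) (hg : ContMDiff (𝓡 (2 * n)) (𝓡 (2 * n)) ∞ g)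
    (hk : ContMDiff (𝓡 (2 * n)) (𝓡 (2 * n)) ∞ k) (hgk : ∀ x, g (k x) = x)
    (hkg : ∀ x, k (g x) = x) {α β : smoothSections (n := n) L} (hα : α ≠ 0) (hβ : β ≠ 0)
    (hαβ : ∀ x, (β : Π x : M, L x) (g x) = Φ.map x ((α : Π x : M, L x) x))
    (q : ℙ ℂ (smoothSections (n := n) L)) :
    IsTransported nabla g (Projectivization.mk ℂ α hα) q ↔ q = Projectivization.mk ℂ β hβ := by
  constructor
  · rintro ⟨Ψ, α', β', hα', hβ', hp, rfl, h⟩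
    obtain ⟨a, ha'⟩ := (Projectivization.mk_eq_mk_iff' ℂ α' α hα' hα).mp hp
    obtain ⟨c, hc⟩ := Φ.exists_map_eq_smul ha hL hg hk hgk hkg Ψ
    -- The factor a comes from the choice of representative of p, the factor c from the choice of
    -- lift.
    refine (Projectivization.mk_eq_mk_iff' ℂ β' β hβ' hβ).mpr ⟨a * c, ?_⟩
    refine Subtype.ext (funext fun y => ?_)
    obtain ⟨x, rfl⟩ : ∃ x, g x = y := ⟨k y, hgk y⟩
    rw [h, hc, ← ha']
    change (a * c) • (β : Π x : M, L x) (g x) = c • Φ.map x (a • (α : Π x : M, L x) x)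
    rw [hαβ, map_smul, smul_smul, mul_comm]
  · rintro rfl
    exact ⟨Φ, α, β, hα, hβ, rfl, rfl, hαβ⟩

theorem IsHamiltonianFlow.image_mem_bohrSommerfeldCycles [T2Space M]
    (hφ : IsHamiltonianFlow Ω F φ) (ha : IsPrequantumConnection Ω nabla)
    (hL : IsSmoothHermitian (n := n) L) {t : ℝ} (Φ : PrequantumLift nabla (φ t))
    {o : integralHomology n S₀} {κ : integralHomology n M} {S : Set M}
    (hS : S ∈ bohrSommerfeldCycles Ω nabla o κ) :
    φ t '' S ∈ bohrSommerfeldCycles Ω nabla o κ := by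
  obtain ⟨i, hi, rfl, hκ, σ, hσ⟩ := hS
  refine ⟨ContinuousMap.comp ⟨φ t, (hφ.contMDiff t).continuous⟩ i,
    hi.comp_lift Φ ha (hφ.contMDiff t) (hφ.contMDiff (-t)) (hφ.apply_neg t) (hφ.neg_apply t),
    Set.range_comp (φ t) i, ?_, _, hσ.comp_lift hi.embedding.contMDiff hL Φ (hφ.contMDiff t)
      (hφ.contMDiff (-t)) (hφ.apply_neg t) (hφ.neg_apply t)⟩
  rw [hφ.integralHomologyMap_comp, hκ]

end FlowAction

end

/-! ### The main theorem -/

theorem proposition6 {n : ℕ} {M : Type u} [TopologicalSpace M] [T2Space M] [CompactSpace M]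
    [SimplyConnectedSpace M] [ChartedSpace (EuclideanSpace ℝ (Fin (2 * n))) M]
    [IsManifold (𝓡 (2 * n)) ∞ M] (Ω : SymplecticForm n M)
    (L : M → Type v) [∀ x, NormedAddCommGroup (L x)] [∀ x, InnerProductSpace ℂ (L x)]
    [TopologicalSpace (TotalSpace ℂ L)] [FiberBundle ℂ L] [VectorBundle ℂ ℂ L]
    [VectorBundle ℝ ℂ L] [ContMDiffVectorBundle ∞ ℂ L (𝓡 (2 * n))]
    (hL : IsSmoothHermitian (n := n) L)
    (nabla : CovariantDerivative (𝓡 (2 * n)) ℂ L) (ha : IsPrequantumConnection Ω nabla)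
    {S₀ : Type u} [TopologicalSpace S₀] [T2Space S₀] [CompactSpace S₀] [ConnectedSpace S₀]
    [ChartedSpace (EuclideanSpace ℝ (Fin n)) S₀] [IsManifold (𝓡 n) ∞ S₀]
    (o : integralHomology n S₀) (ho : IsFundamentalClass n S₀ o) (κ : integralHomology n M)
    (F : M → ℝ) (hF : ContMDiff (𝓡 (2 * n)) 𝓘(ℝ, ℝ) ∞ F)
    (φ : ℝ → M → M) (hφ : IsHamiltonianFlow Ω F φ)
    (p : ℙ ℂ (smoothSections (n := n) L)) (S : Set M)
    (hpS : (p, S) ∈ universalSBS Ω nabla o κ) (t : ℝ) :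
    ∃ q : ℙ ℂ (smoothSections (n := n) L),
      -- the class `q = φ^t(p)` exists and is unique
      (∀ q' : ℙ ℂ (smoothSections (n := n) L), IsTransported nabla (φ t) p q' ↔ q' = q) ∧
      -- the transported pair is special Bohr-Sommerfeld
      (q, φ t '' S) ∈ universalSBS Ω nabla o κ ∧
      -- the picture in terms of 1-forms, when the flow preserves the zero set of `p`
      (φ t '' zeroSet p = zeroSet p →
        S ∩ zeroSet p = ∅ ∧ φ t '' S ∩ zeroSet p = ∅ ∧
        ImVanishesOn S₀ (rhoForm nabla p) S ∧
        IsRhoTransported nabla (φ t) p q ∧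
        (∀ q' : ℙ ℂ (smoothSections (n := n) L), IsRhoTransported nabla (φ t) p q' →
          ImVanishesOn S₀ (rhoForm nabla q') (φ t '' S) ∧
          (q', φ t '' S) ∈ universalSBS Ω nabla o κ ∧
          (IsConnected (zeroSet p)ᶜ → q' = q))) := by
  have : PathConnectedSpace M := inferInstance
  have : ConnectedSpace M := inferInstance
  obtain ⟨Φ⟩ := ha.nonempty_lift hL hφ hF t
  have hg := hφ.contMDiff t
  have hk := hφ.contMDiff (-t)
  have hgk := hφ.apply_neg t
  have hkg := hφ.neg_apply t
  obtain ⟨hS, α, hα, hp, i, hi, hr, σ, hσ, c, f, hf, hpos, hασ⟩ := hpS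
  dsimp only at hS hp hr
  subst hp hr
  obtain ⟨b, hb, hαb⟩ := Φ.exists_push hk hgk hkg α.2
  set β : smoothSections (n := n) L := ⟨b, hb⟩ with hβdef
  replace hαb : ∀ x, (β : Π x : M, L x) (φ t x) = Φ.map x ((α : Π x : M, L x) x) := hαb
  have hβ : β ≠ 0 := by
    intro h0
    refine hα (Subtype.ext (funext fun x => (Φ.map x).injective ?_))
    rw [← hαb, h0]
    exact (map_zero _).symm
  have hS' := hφ.image_mem_bohrSommerfeldCycles ha hL Φ hS
  set i' : C(S₀, M) := ContinuousMap.comp ⟨φ t, hg.continuous⟩ i with hi'def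
  have hi' : IsLagrangianEmbedding Ω i' := hi.comp_lift Φ ha hg hk hgk hkg
  have hr' : Set.range i' = φ t '' Set.range i := Set.range_comp (φ t) i
  have hσ' : IsParallelFrameAlong nabla i' (fun s => Φ.map (i s) (σ s)) :=
    hσ.comp_lift hi.embedding.contMDiff hL Φ hg hk hgk hkg
  have hβσ : ∀ s, (β : Π x : M, L x) (i' s)
      = (Complex.exp (Complex.I * c) * (f s : ℂ)) • Φ.map (i s) (σ s) := fun s =>
    (hαb (i s)).trans (by rw [hασ, map_smul])
  have hne : ∀ s, (α : Π x : M, L x) (i s) ≠ 0 := fun s => by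
    rw [hασ]
    exact smul_ne_zero (mul_ne_zero (Complex.exp_ne_zero _)
      (by exact_mod_cast (hpos s).ne')) (hσ.ne_zero s)
  refine ⟨Projectivization.mk ℂ β hβ,
    Φ.isTransported_iff ha hL hg hk hgk hkg hα hβ hαb,
    ⟨hS', β, hβ, rfl, i', hi', hr', _, hσ', c, f, hf, hpos, hβσ⟩, fun hD => ?_⟩
  set D := zeroSet (Projectivization.mk ℂ α hα) with hDdef
  -- Invariance of D enters here: it makes the zero set of β, which is φ^t(D), equal to D.
  have hmem : ∀ x, φ t x ∈ D ↔ x ∈ D := fun x => by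
    conv_lhs => rw [← hD]
    exact (Function.LeftInverse.injective hkg).mem_set_image
  have hαD : ∀ x, x ∈ D ↔ (α : Π x : M, L x) x = 0 := mem_zeroSet_mk hα
  have hβD : ∀ x, x ∈ D ↔ (β : Π x : M, L x) x = 0 := fun x => by
    obtain ⟨y, rfl⟩ : ∃ y, φ t y = x := ⟨_, hgk x⟩
    rw [hmem, hαD, hαb]
    simp
  have hiD : ∀ s, i s ∉ D := fun s h => hne s ((hαD _).mp h)
  have hi'D : ∀ s, i' s ∉ D := fun s h => hiD s ((hmem _).mp h)
  have hrho : ∀ x ∉ D, ∀ w : TangentSpace (𝓡 (2 * n)) x,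
      connForm nabla β (φ t x) (mfderiv (𝓡 (2 * n)) (𝓡 (2 * n)) (φ t) x w)
        = rhoForm nabla (Projectivization.mk ℂ α hα) x w := fun x hx w => by
    rw [ha.rhoForm_mk hα]
    exact Φ.connForm_apply α.2 β.2 hαb (fun h => hx ((hαD x).mpr h)) w
  have hIm : ∀ (s : S₀) (w : TangentSpace (𝓡 n) s), (rhoForm nabla (Projectivization.mk ℂ α hα)
      (i s) (mfderiv (𝓡 n) (𝓡 (2 * n)) i s w)).im = 0 := fun s w => by
    rw [ha.rhoForm_mk hα]
    exact hσ.im_connForm α.2 hf hpos hασ s w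
  refine ⟨?_, ?_, imVanishesOn_of_embedding hi.embedding hIm, ⟨?_, ?_⟩, ?_⟩
  · rw [Set.eq_empty_iff_forall_notMem]
    rintro _ ⟨⟨s, rfl⟩, h⟩
    exact hiD s h
  · rw [← hr', Set.eq_empty_iff_forall_notMem]
    rintro _ ⟨⟨s, rfl⟩, h⟩
    exact hi'D s h
  · exact Set.ext fun x => (mem_zeroSet_mk hβ x).trans (hβD x).symm
  · intro x hx w
    rw [ha.rhoForm_mk hβ]
    exact hrho x hx w
  · rintro q' ⟨hq'D, hq'⟩
    have hIm' : ∀ (s : S₀) (w : TangentSpace (𝓡 n) s), (rhoForm nabla q' (i' s)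
        (mfderiv (𝓡 n) (𝓡 (2 * n)) i' s w)).im = 0 := fun s w => by
      have h1 := mfderiv_comp_apply_of_smooth hg hi.embedding.contMDiff s w
      have h2 := hq' (i s) (hiD s) (mfderiv (𝓡 n) (𝓡 (2 * n)) i s w)
      rw [← h1] at h2
      exact (congrArg Complex.im h2).trans (hIm s w)
    have hβ'D : ∀ x, x ∈ D ↔ (q'.rep : Π x : M, L x) x = 0 := fun x => by
      rw [hDdef, ← hq'D]
      rfl
    -- q' and β have the same 1-form off D, so they are proportional on connected sets there; the
    -- constant may depend on the component.
    have hprop : ∀ T ⊆ Dᶜ, IsConnected T →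
        ∃ c : ℂ, ∀ x ∈ T, (q'.rep : Π x : M, L x) x = c • (β : Π x : M, L x) x := by
      intro T hT hTc
      refine ha.exists_eq_smul_on hL β.2 q'.rep.2 (isOpen_compl_zeroSet hL _)
        (fun x hx h => hx ((hβD x).mpr h)) (fun x hx w => ?_) hTc hT
      obtain ⟨y, rfl⟩ : ∃ y, φ t y = x := ⟨_, hgk x⟩
      have hy : y ∉ D := fun h => hx ((hmem y).mpr h)
      obtain ⟨w, rfl⟩ := exists_mfderiv_eq (hk.mdifferentiable (by simp))
        (hg.mdifferentiable (by simp)) hkg hgk y w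
      rw [hrho y hy, ← hq' y hy w]
      exact (connForm_smul (fun h => hx ((hβ'D _).mpr h)) _).symm
    refine ⟨?_, ⟨hS', ?_⟩, fun hconn => ?_⟩
    · rw [← hr']
      exact imVanishesOn_of_embedding hi'.embedding hIm'
    · obtain ⟨a, hac⟩ := hprop (Set.range i') (by rintro _ ⟨s, rfl⟩; exact hi'D s)
        -- M∖D may be disconnected, but φ^t(S) is connected, so one constant a is enough along it; a
        -- ≠ 0 since q' does not vanish there.
        (isConnected_range i'.continuous)
      have ha0 : a ≠ 0 := by
        rintro rfl
        obtain ⟨s⟩ : Nonempty S₀ := inferInstance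
        exact hi'D s ((hβ'D _).mpr (by rw [hac _ ⟨s, rfl⟩, zero_smul]))
      -- Polar form a = |a| e^{i arg a}: the modulus goes into f, the argument into c.
      refine ⟨q'.rep, q'.rep_nonzero, q'.mk_rep, i', hi', hr', _, hσ', c + a.arg,
        fun s => ‖a‖ * f s, ?_, fun s => mul_pos (norm_pos_iff.mpr ha0) (hpos s), fun s => ?_⟩
      · exact contMDiff_const.mul hf
      · rw [hac _ ⟨s, rfl⟩, hβσ, smul_smul]
        congr 1
        have h1 := Complex.norm_mul_exp_arg_mul_I a
        conv_lhs => rw [← h1]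
        push_cast
        rw [mul_add, Complex.exp_add, mul_comm (a.arg : ℂ)]
        ring
    · obtain ⟨a, hac⟩ := hprop Dᶜ subset_rfl hconn
      rw [← q'.mk_rep]
      refine (Projectivization.mk_eq_mk_iff' ℂ _ _ q'.rep_nonzero hβ).mpr ⟨a, ?_⟩
      refine Subtype.ext (funext fun x => ?_)
      -- Proportionality is known off D, and on D both sections vanish.
      by_cases hx : x ∈ D
      · have h1 : a • (β : Π x : M, L x) x = 0 := by rw [(hβD x).mp hx, smul_zero]
        exact h1.trans ((hβ'D x).mp hx).symm
      · exact (hac x hx).symm
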